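/- **Definitions.** Let $\Sigma$ be a finite nonempty alphabet and let $\Sigma_{hi},\Sigma_o\subseteq\Sigma$ be nonempty subsets (of high-level and of observable letters; $\Sigma_{hi}\cap\Sigma_o$ may be empty). For $\Sigma_0\subseteq\Sigma$, the natural projection $\Sigma^*\to\Sigma_0^*$ is the homomorphism that fixes the letters in $\Sigma_0$ and maps every other letter to the empty word. Let $A:\Sigma^*\to\Sigma_{hi}^*$, $P:\Sigma^*\to\Sigma_o^*$ and $P_{hi}:\Sigma_{hi}^*\to(\Sigma_{hi}\cap\Sigma_o)^*$ be the natural projections. A prefix-closed language $L\subseteq\Sigma^*$ is *observation consistent* with respect to $A$, $P$ and $P_{hi}$ if for all $t,t'\in A(L)$ with $P_{hi}(t)=P_{hi}(t')$ there exist $s,s'\in L$ such that $A(s)=t$, $A(s')=t'$ and $P(s)=P(s')$. A language is *linear* if it is generated by a context-free grammar each of whose productions has at most one nonterminal on its right-hand side, and *deterministic context-free* if it is accepted by final state by a deterministic pushdown automaton. **Theorem.** The observation consistency condition for linear, deterministic context-free languages is undecidable. That is, there is no algorithm that, given $\Sigma$, $\Sigma_{hi}$, $\Sigma_o$ and a prefix-closed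 language $L\subseteq\Sigma^*$ that is both linear and deterministic context-free, decides whether $L$ is observation consistent with respect to $A$, $P$ and $P_{hi}$. This holds even if $L$ is given both by a linear grammar and by a deterministic pushdown automaton, and even if the algorithm may behave arbitrarily (in particular, not halt) on inputs that do not consist of two such descriptions of one and the same prefix-closed language over $\Sigma$. -/

import Mathlib

namespace ObsCons

section Languages

variable {α : Type*}

/-- The natural projection onto the letters in `S`: the word homomorphism that keeps the letters
of `S` and sends every other letter to the empty word. -/
noncomputable def proj (S : Set α) (w : List α) : List α :=
  open Classical in w.filter fun a => decide (a ∈ S)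

/-- The prefix closure of a language. -/
def prefixClosure (L : Language α) : Language α :=
  {w | ∃ v : List α, w ++ v ∈ L}

/-- A language is prefix-closed if it equals its prefix closure. -/
def IsPrefixClosed (L : Language α) : Prop :=
  L = prefixClosure L

/-- Observation consistency of a (prefix-closed) language `L` for the set `high` of high-level
letters and the set `obs` of observable letters. Here `A = proj high`, `P = proj obs` and
`P_hi = proj (high ∩ obs)`, and `A(L)` is the image of `L` under `A`. -/
def ObservationConsistent (high obs : Set α) (L : Language α) : Prop :=
  ∀ t ∈ proj high '' (L : Set (List α)), ∀ t' ∈ proj high '' (L : Set (List α)),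
    proj (high ∩ obs) t = proj (high ∩ obs) t' →
      ∃ s ∈ L, ∃ s' ∈ L, proj high s = t ∧ proj high s' = t' ∧ proj obs s = proj obs s'

end Languages

/-! ### Linear context-free grammars as finite data

Letters and nonterminals are natural numbers (two separate copies of them). -/

/-- A linear production: `A → u` if `tail = none`, and `A → u B v` if `tail = some (B, v)`,
where `A = lhs` and `u = left`. -/
structure LinearRule where
  lhs : ℕ
  left : List ℕ
  tail : Option (ℕ × List ℕ)

/-- The right-hand side of a linear production. -/
def LinearRule.output (r : LinearRule) : List (Symbol ℕ ℕ) :=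
  r.left.map Symbol.terminal ++
    match r.tail with
    | none => []
    | some (B, v) => Symbol.nonterminal B :: v.map Symbol.terminal

/-- The letters that occur in a linear production. -/
def LinearRule.letters (r : LinearRule) : List ℕ :=
  r.left ++
    match r.tail with
    | none => []
    | some (_, v) => v

/-- A linear grammar: a start symbol and a finite list of linear productions. -/
structure LinearGrammar where
  start : ℕ
  rules : List LinearRule

/-- The context-free grammar given by a linear grammar. -/
abbrev LinearGrammar.toCFG (g : LinearGrammar) : ContextFreeGrammar ℕ where
  NT := ℕ
  initial := g.start
  rules := (g.rules.map fun r => (⟨r.lhs, r.output⟩ : ContextFreeRule ℕ ℕ)).toFinset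

/-- The language generated by a linear grammar. -/
def LinearGrammar.language (g : LinearGrammar) : Language ℕ :=
  g.toCFG.language

/-! ### Pushdown automata as finite data

States, stack symbols and input letters are natural numbers; the finitely many states and stack
symbols that matter are those that are mentioned in the data. -/

/-- A move of a pushdown automaton: in state `src` with `top` on top of the stack, read `input`
(nothing if `input = none`), go to state `dst` and replace `top` by the word `push`, whose first
symbol becomes the new top of the stack. -/
structure Move where
  src : ℕ
  input : Option ℕ
  top : ℕ
  dst : ℕ
  push : List ℕ

/-- A pushdown automaton: initial state, initial stack symbol, accepting states, moves. -/
structure PDA where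
  start : ℕ
  bottom : ℕ
  final : List ℕ
  moves : List Move

/-- One step between configurations (state, unread input, stack with its top first). -/
inductive PDA.Step (M : PDA) : ℕ × List ℕ × List ℕ → ℕ × List ℕ × List ℕ → Prop
  | mk (m : Move) (hm : m ∈ M.moves) (w β : List ℕ) :
      PDA.Step M (m.src, m.input.toList ++ w, m.top :: β) (m.dst, w, m.push ++ β)

/-- The language accepted by final state. -/
def PDA.language (M : PDA) : Language ℕ :=
  {w | ∃ q ∈ M.final, ∃ β : List ℕ,
    Relation.ReflTransGen M.Step (M.start, w, [M.bottom]) (q, [], β)}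

/-- A pushdown automaton is deterministic if, for each state and top stack symbol, there is at
most one move for each letter, at most one move that reads nothing, and no move that reads a
letter if there is one that reads nothing. -/
def PDA.IsDeterministic (M : PDA) : Prop :=
  ∀ m ∈ M.moves, ∀ m' ∈ M.moves, m.src = m'.src → m.top = m'.top →
    (m.input = m'.input ∨ m.input = none) → m = m'

/-! ### Instances of the decision problem -/

/-- An input of the decision problem: an alphabet, its high-level letters, its observable letters,
and a language described twice, by a linear grammar and by a pushdown automaton. -/
structure Instance where
  alphabet : List ℕ
  high : List ℕ
  obs : List ℕ
  grammar : LinearGrammar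
  automaton : PDA

namespace Instance

/-- The language of an instance. -/
def language (I : Instance) : Language ℕ :=
  I.grammar.language

/-- The admissible inputs: `high` and `obs` are nonempty subsets of the alphabet, both devices
are over the alphabet, the automaton is deterministic, both devices describe the same
language, and this language is prefix-closed. -/
structure Admissible (I : Instance) : Prop where
  high_ne : I.high ≠ []
  obs_ne : I.obs ≠ []
  high_sub : I.high ⊆ I.alphabet
  obs_sub : I.obs ⊆ I.alphabet
  grammar_letters : ∀ r ∈ I.grammar.rules, r.letters ⊆ I.alphabet
  automaton_letters : ∀ m ∈ I.automaton.moves, ∀ a ∈ m.input, a ∈ I.alphabet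
  deterministic : I.automaton.IsDeterministic
  same_language : I.automaton.language = I.grammar.language
  prefixClosed : IsPrefixClosed I.language

/-- Observation consistency of the language of an instance. -/
def IsObservationConsistent (I : Instance) : Prop :=
  ObservationConsistent {a | a ∈ I.high} {a | a ∈ I.obs} I.language

end Instance

/-! ### Coding of the data

Each structure is coded as the tuple of its fields. -/

def LinearRule.equivProd : LinearRule ≃ ℕ × List ℕ × Option (ℕ × List ℕ) where
  toFun r := (r.lhs, r.left, r.tail)
  invFun p := ⟨p.1, p.2.1, p.2.2⟩
  left_inv _ := rfl
  right_inv _ := rfl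

instance instPrimcodableLinearRule : Primcodable LinearRule :=
  Primcodable.ofEquiv _ LinearRule.equivProd

def LinearGrammar.equivProd : LinearGrammar ≃ ℕ × List LinearRule where
  toFun g := (g.start, g.rules)
  invFun p := ⟨p.1, p.2⟩
  left_inv _ := rfl
  right_inv _ := rfl

instance instPrimcodableLinearGrammar : Primcodable LinearGrammar :=
  Primcodable.ofEquiv _ LinearGrammar.equivProd

def Move.equivProd : Move ≃ ℕ × Option ℕ × ℕ × ℕ × List ℕ where
  toFun m := (m.src, m.input, m.top, m.dst, m.push)
  invFun p := ⟨p.1, p.2.1, p.2.2.1, p.2.2.2.1, p.2.2.2.2⟩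
  left_inv _ := rfl
  right_inv _ := rfl

instance instPrimcodableMove : Primcodable Move :=
  Primcodable.ofEquiv _ Move.equivProd

def PDA.equivProd : PDA ≃ ℕ × ℕ × List ℕ × List Move where
  toFun M := (M.start, M.bottom, M.final, M.moves)
  invFun p := ⟨p.1, p.2.1, p.2.2.1, p.2.2.2⟩
  left_inv _ := rfl
  right_inv _ := rfl

instance instPrimcodablePDA : Primcodable PDA :=
  Primcodable.ofEquiv _ PDA.equivProd

def Instance.equivProd : Instance ≃ List ℕ × List ℕ × List ℕ × LinearGrammar × PDA where
  toFun I := (I.alphabet, I.high, I.obs, I.grammar, I.automaton)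
  invFun p := ⟨p.1, p.2.1, p.2.2.1, p.2.2.2.1, p.2.2.2.2⟩
  left_inv _ := rfl
  right_inv _ := rfl

instance instPrimcodableInstance : Primcodable Instance :=
  Primcodable.ofEquiv _ Instance.equivProd

end ObsCons

/-! The halting problem is reduced to observation consistency through string rewriting and a tiling
equation in the style of Post's correspondence problem. Two branches, marked by the unobservable
letters `0` and `1`, read an index word `I`, the separator `2`, and the word that `I` produces in
that branch. Each closes with its own unobservable high-level letter, `3` or `4`. The other letters
are observable and not high-level, so P_hi erases everything, and the only real demand of
consistency is that `[3]` and `[4]` have preimages with equal observations. An observation shows `I`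
and the word produced, so the condition says exactly that some `I` produces the same word in both
branches (`observationConsistent_branchLanguage_iff`). Each branch unfolds its indices in reverse
order. A linear grammar can therefore nest an index with its word, and a deterministic pushdown
automaton can push the words and pop them. Prefixes cost only a few more productions and accepting
states (`language_branchGrammar`, `language_branchPDA`). With tiles as indices, one branch produces
the tops followed by `# f`, the other `w #` followed by the bottoms. Equality means that `w`
rewrites to `f` (`exists_tiling_iff`, `exists_branch_eq_iff`). A rewriting system simulates a Turing
machine and erases its tape after halting, so reachability of one fixed word is halting
(`rewrites_iff_halts`). The machine is fixed, and its inputs are `L ++ replicate m z`, the codes of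
the powers of two. Only the word `pre` of one branch thus varies with `m`, which makes the reduction
visibly computable. -/

namespace ObsCons

/-! ### Words -/

/-- The only letter with property `P` determines the decomposition of a word around it. -/
theorem append_cons_inj_of_pred {α : Type*} (P : α → Prop) {x y x' y' : List α} {a a' : α}
    (ha' : P a') (hx : ∀ b ∈ x, ¬ P b) (hy : ∀ b ∈ y, ¬ P b)
    (h : x ++ a :: y = x' ++ a' :: y') : x = x' ∧ a = a' ∧ y = y' := by
  induction x generalizing x' with
  | nil =>
    cases x' with
    | nil => simpa using h
    | cons c x' =>
      simp only [List.nil_append, List.cons_append, List.cons.injEq] at h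
      exact absurd ha' (hy a' (by simp [h.2]))
  | cons b x ih =>
    cases x' with
    | nil =>
      simp only [List.nil_append, List.cons_append, List.cons.injEq] at h
      exact absurd ha' (h.1 ▸ hx b (by simp))
    | cons c x' =>
      simp only [List.cons_append, List.cons.injEq] at h
      obtain ⟨rfl, rfl, rfl⟩ := ih (fun b hb => hx b (by simp [hb])) h.2
      simp [h.1]

theorem prefix_append_iff {α : Type*} {x a b : List α} :
    x <+: a ++ b ↔ x <+: a ∨ ∃ y, y <+: b ∧ x = a ++ y := by
  constructor
  · rintro ⟨t, ht⟩
    rcases List.append_eq_append_iff.1 ht with ⟨c, h1, h2⟩ | ⟨c, h1, h2⟩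
    · exact Or.inl ⟨c, h1.symm⟩
    · exact Or.inr ⟨c, ⟨t, h2.symm⟩, h1⟩
  · rintro (h | ⟨y, h, rfl⟩)
    · exact h.trans (List.prefix_append _ _)
    · simpa using h

/-! ### Derivations of linear grammars -/

/-- `g.Derives A w`: the nonterminal `A` generates the word `w`. -/
inductive LinearGrammar.Derives (g : LinearGrammar) : ℕ → List ℕ → Prop
  | leaf (A : ℕ) (x : List ℕ) : ⟨A, x, none⟩ ∈ g.rules → Derives g A x
  | step (A : ℕ) (x : List ℕ) (B : ℕ) (y w : List ℕ) : ⟨A, x, some (B, y)⟩ ∈ g.rules →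
      Derives g B w → Derives g A (x ++ w ++ y)

theorem LinearGrammar.produces_iff {g : LinearGrammar} {s t : List (Symbol ℕ ℕ)} :
    g.toCFG.Produces s t ↔ ∃ r ∈ g.rules, ∃ p q, s = p ++ Symbol.nonterminal r.lhs :: q ∧
      t = p ++ r.output ++ q := by
  unfold ContextFreeGrammar.Produces
  simp only [LinearGrammar.toCFG, List.mem_toFinset, List.mem_map, ContextFreeRule.rewrites_iff]
  constructor
  · rintro ⟨_, ⟨r, hr, rfl⟩, p, q, hs, ht⟩
    exact ⟨r, hr, p, q, by simpa using hs, ht⟩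
  · rintro ⟨r, hr, p, q, hs, ht⟩
    exact ⟨_, ⟨r, hr, rfl⟩, p, q, by simpa using hs, ht⟩

theorem LinearGrammar.eq_of_derives_terminals {g : LinearGrammar} {x : List ℕ}
    {t : List (Symbol ℕ ℕ)} (h : g.toCFG.Derives (x.map Symbol.terminal) t) :
    t = x.map Symbol.terminal := by
  rcases Relation.ReflTransGen.cases_head h with h | ⟨s, h, -⟩
  · exact h.symm
  · obtain ⟨r, -, p, q, h, -⟩ := produces_iff.1 h
    have : Symbol.nonterminal r.lhs ∈ x.map (Symbol.terminal (N := ℕ)) := by rw [h]; simp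
    simp at this

/-- A sentential form with one nonterminal keeps at most one under linear productions. The terminal
contexts `x` and `y` are arbitrary so that the induction on the first step can absorb the terminals
it adds. -/
theorem LinearGrammar.derives_of_toCFG_derives {g : LinearGrammar} {w : List ℕ}
    {s : List (Symbol ℕ ℕ)} (h : g.toCFG.Derives s (w.map Symbol.terminal)) :
    ∀ (x : List ℕ) (A : ℕ) (y : List ℕ), s = x.map Symbol.terminal ++ Symbol.nonterminal A ::
      y.map Symbol.terminal → ∃ v, g.Derives A v ∧ w = x ++ v ++ y := by
  have inj : Function.Injective (Symbol.terminal : ℕ → Symbol ℕ ℕ) := fun a b h => by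
    simpa using h
  induction h using Relation.ReflTransGen.head_induction_on with
  | refl =>
    intro x A y h
    have : Symbol.nonterminal A ∈ w.map (Symbol.terminal (N := ℕ)) := by rw [h]; simp
    simp at this
  | head hst htw ih =>
    rintro x A y rfl
    obtain ⟨r, hr, p, q, h, rfl⟩ := produces_iff.1 hst
    obtain ⟨rfl, hA, rfl⟩ := append_cons_inj_of_pred
      (fun b => ∃ n, b = Symbol.nonterminal (T := ℕ) (N := ℕ) n) ⟨_, rfl⟩
      (by simp) (by simp) h
    obtain ⟨A', l, tl⟩ := r
    simp only [Symbol.nonterminal.injEq] at hA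
    subst hA
    rcases tl with _ | ⟨B, z⟩
    · refine ⟨l, .leaf _ _ hr, ?_⟩
      have := eq_of_derives_terminals (x := x ++ l ++ y) (by
        simpa [LinearRule.output] using htw)
      exact List.map_injective_iff.2 inj this
    · obtain ⟨v, hv, rfl⟩ := ih (x ++ l) B (z ++ y) (by simp [LinearRule.output])
      exact ⟨_, .step _ _ _ _ _ hr hv, by simp⟩

theorem LinearGrammar.Derives.toCFG {g : LinearGrammar} {A : ℕ} {w : List ℕ}
    (h : g.Derives A w) : g.toCFG.Derives [Symbol.nonterminal A] (w.map Symbol.terminal) := by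
  induction h with
  | leaf A x h => exact .single (produces_iff.2 ⟨_, h, [], [], by simp [LinearRule.output]⟩)
  | step A x B y w h _ ih =>
    refine .head (produces_iff.2 ⟨_, h, [], [], rfl, rfl⟩) ?_
    simpa [LinearRule.output] using
      (ih.append_left (x.map Symbol.terminal)).append_right (y.map Symbol.terminal)

theorem LinearGrammar.mem_language_iff {g : LinearGrammar} {w : List ℕ} :
    w ∈ g.language ↔ g.Derives g.start w := by
  constructor
  · intro h
    obtain ⟨v, hv, rfl⟩ := derives_of_toCFG_derives h [] g.start [] rfl
    simpa using hv
  · exact fun h => h.toCFG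

theorem LinearGrammar.derives_iff {g : LinearGrammar} {A : ℕ} {w : List ℕ} :
    g.Derives A w ↔ ⟨A, w, none⟩ ∈ g.rules ∨ ∃ x B y v, ⟨A, x, some (B, y)⟩ ∈ g.rules ∧
      g.Derives B v ∧ w = x ++ v ++ y := by
  constructor
  · rintro (⟨_, _, h⟩ | ⟨_, x, B, y, v, h, h'⟩)
    · exact Or.inl h
    · exact Or.inr ⟨x, B, y, v, h, h', rfl⟩
  · rintro (h | ⟨x, B, y, v, h, h', rfl⟩)
    · exact .leaf _ _ h
    · exact .step _ _ _ _ _ h h'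

/-! ### Real-time pushdown automata -/

/-- `M.Accepts q w β`: the word `w` is accepted from state `q` with stack `β`. -/
def PDA.Accepts (M : PDA) (q : ℕ) (w β : List ℕ) : Prop :=
  ∃ q' ∈ M.final, ∃ β' : List ℕ, Relation.ReflTransGen M.Step (q, w, β) (q', [], β')

/-- Without silent moves every step consumes one letter, so acceptance becomes a recursion on the
input word (`PDA.accepts_nil`, `PDA.accepts_cons`). -/
theorem PDA.step_iff {M : PDA} (hM : ∀ m ∈ M.moves, m.input ≠ none) {q : ℕ} {w β : List ℕ}
    {c : ℕ × List ℕ × List ℕ} : M.Step (q, w, β) c ↔ ∃ a w' t β', w = a :: w' ∧ β = t :: β' ∧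
      ∃ q' p, ⟨q, some a, t, q', p⟩ ∈ M.moves ∧ c = (q', w', p ++ β') := by
  constructor
  · intro h
    generalize hc : (q, w, β) = c₀ at h
    obtain ⟨⟨s, i, t, q', p⟩, hm, w', β'⟩ := h
    rcases i with _ | a
    · exact absurd rfl (hM _ hm)
    · simp only [Option.toList_some, List.cons_append, List.nil_append, Prod.mk.injEq] at hc
      obtain ⟨rfl, rfl, rfl⟩ := hc
      exact ⟨a, w', t, β', rfl, rfl, q', p, hm, rfl⟩
  · rintro ⟨a, w', t, β', rfl, rfl, q', p, hm, rfl⟩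
    exact PDA.Step.mk _ hm w' β'

theorem PDA.accepts_nil {M : PDA} (hM : ∀ m ∈ M.moves, m.input ≠ none) {q : ℕ} {β : List ℕ} :
    M.Accepts q [] β ↔ q ∈ M.final := by
  constructor
  · rintro ⟨q', hq', β', h⟩
    rcases Relation.ReflTransGen.cases_head h with h | ⟨c, h, -⟩
    · cases h; exact hq'
    · obtain ⟨a, w', t, β', h, -⟩ := (step_iff hM).1 h
      simp at h
  · exact fun h => ⟨q, h, β, .refl⟩

theorem PDA.accepts_cons {M : PDA} (hM : ∀ m ∈ M.moves, m.input ≠ none) {q a : ℕ}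
    {w β : List ℕ} : M.Accepts q (a :: w) β ↔ ∃ t β', β = t :: β' ∧
      ∃ q' p, ⟨q, some a, t, q', p⟩ ∈ M.moves ∧ M.Accepts q' w (p ++ β') := by
  constructor
  · rintro ⟨q', hq', β', h⟩
    rcases Relation.ReflTransGen.cases_head h with h | ⟨c, h, h'⟩
    · simp at h
    · obtain ⟨_, _, t, β', hw, rfl, q'', p, hm, rfl⟩ := (step_iff hM).1 h
      cases hw
      exact ⟨t, β', rfl, q'', p, hm, q', hq', _, h'⟩
  · rintro ⟨t, β', rfl, q', p, hm, q'', hq, β'', h⟩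
    exact ⟨q'', hq, β'', .head ((step_iff hM).2 ⟨a, w, t, β', rfl, rfl, q', p, hm, rfl⟩) h⟩

/-! ### The two-branch languages

The letters `0` and `1` open the two branches, `2` separates a word of indices from the word that
it produces, and `3`, `4` close the two branches. -/

/-- One branch: the index `i` produces the word `u i`; the words `pre` and `post` are added at the
two ends. -/
structure Branch where
  u : ℕ → List ℕ
  pre : List ℕ
  post : List ℕ

/-- The word produced by a word of indices, apart from the final part `post`. -/
def Branch.out (h : Branch) (I : List ℕ) : List ℕ :=
  h.pre ++ I.reverse.flatMap h.u

theorem Branch.out_nil (h : Branch) : h.out [] = h.pre := by simp [out]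

theorem Branch.out_cons (h : Branch) (i : ℕ) (I : List ℕ) : h.out (i :: I) = h.out I ++ h.u i := by
  simp [out]

/-- The prefixes of all words `b I 2 x (3 + b)`, where `x` is produced by `I` in branch `b`. -/
def branchLanguage (idx : List ℕ) (H : Bool → Branch) : Language ℕ :=
  {w | w = [] ∨ ∃ (b : Bool) (I : List ℕ), I ⊆ idx ∧ (w = b.toNat :: I ∨
    ∃ x, x <+: (H b).out I ++ ((H b).post ++ [3 + b.toNat]) ∧ w = b.toNat :: I ++ 2 :: x)}

theorem isPrefixClosed_branchLanguage (idx : List ℕ) (H : Bool → Branch) :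
    IsPrefixClosed (branchLanguage idx H) := by
  apply Set.Subset.antisymm
  · intro w hw
    exact ⟨[], by rw [List.append_nil]; exact hw⟩
  · rintro w ⟨v, h | ⟨b, I, hI, h | ⟨x, hx, h⟩⟩⟩
    · exact Or.inl (List.append_eq_nil_iff.1 h).1
    · rcases w with _ | ⟨c, w⟩
      · exact Or.inl rfl
      · simp only [List.cons_append, List.cons.injEq] at h
        obtain ⟨rfl, rfl⟩ := h
        exact Or.inr ⟨b, w, fun i hi => hI (by simp [hi]), Or.inl rfl⟩
    · rcases w with _ | ⟨c, w⟩
      · exact Or.inl rfl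
      · simp only [List.cons_append, List.cons.injEq] at h
        obtain ⟨rfl, h⟩ := h
        refine Or.inr ⟨b, ?_⟩
        rcases List.append_eq_append_iff.1 h with ⟨y, rfl, -⟩ | ⟨y, rfl, hy⟩
        · exact ⟨w, fun i hi => hI (by simp [hi]), Or.inl rfl⟩
        · rcases y with _ | ⟨c, y⟩
          · exact ⟨I, hI, Or.inl (by simp)⟩
          · simp only [List.cons_append, List.cons.injEq] at hy
            obtain ⟨rfl, rfl⟩ := hy
            exact ⟨I, hI, Or.inr ⟨y, (List.prefix_append _ _).trans hx, rfl⟩⟩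

/-! ### The linear grammar -/

/-- The productions of branch `b`, except those that depend on `pre`. -/
def Branch.fixedRules (h : Branch) (idx : List ℕ) (b : Bool) : List LinearRule :=
  -- Nonterminal `0` is the start, `1 + b` generates the words `I 2 out I`, and `3 + b` generates
  -- those of their prefixes that contain all of `I` or stop within the indices. Cuts inside `post`
  -- and its closing letter are made by the start productions.
  ⟨0, [b.toNat], some (3 + b.toNat, [])⟩ ::
  (h.post ++ [3 + b.toNat]).inits.map (fun y => ⟨0, [b.toNat], some (1 + b.toNat, y)⟩) ++
  idx.map (fun i => ⟨1 + b.toNat, [i], some (1 + b.toNat, h.u i)⟩) ++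
  ⟨3 + b.toNat, [], none⟩ ::
  idx.map (fun i => ⟨3 + b.toNat, [i], some (3 + b.toNat, [])⟩) ++
  idx.flatMap fun i => (h.u i).inits.map fun y => ⟨3 + b.toNat, [i], some (1 + b.toNat, y)⟩

/-- The productions of branch `b` that depend on `pre`. -/
def preRules (pre : List ℕ) (b : Bool) : List LinearRule :=
  ⟨1 + b.toNat, 2 :: pre, none⟩ :: pre.inits.map fun y => ⟨3 + b.toNat, 2 :: y, none⟩

/-- A linear grammar for `branchLanguage idx H`. -/
def branchGrammar (idx : List ℕ) (H : Bool → Branch) : LinearGrammar where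
  start := 0
  rules := (⟨0, [], none⟩ :: (H false).fixedRules idx false ++ (H true).fixedRules idx true ++
    preRules (H false).pre false) ++ preRules (H true).pre true

section

variable {idx : List ℕ} {H : Bool → Branch}

/-- Since `out (i :: I) = out I ++ u i`, one production wraps `i` and `u i` around the word
generated for `I`. This nesting is the reason why `out` runs through the indices backwards. -/
theorem derives_full {b : Bool} {w : List ℕ} :
    (branchGrammar idx H).Derives (1 + b.toNat) w ↔
      ∃ I, I ⊆ idx ∧ w = I ++ 2 :: (H b).out I := by
  have hr : ∀ x t, ⟨1 + b.toNat, x, t⟩ ∈ (branchGrammar idx H).rules ↔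
      (x = 2 :: (H b).pre ∧ t = none) ∨
      ∃ i ∈ idx, x = [i] ∧ t = some (1 + b.toNat, (H b).u i) := by
    intro x t
    cases b <;> simp [branchGrammar, Branch.fixedRules, preRules] <;> grind
  constructor
  · intro h
    generalize hA : 1 + b.toNat = A at h
    induction h with subst hA
    | leaf _ x hx =>
      rcases (hr _ _).1 hx with ⟨rfl, -⟩ | ⟨i, -, -, h⟩
      · exact ⟨[], by simp, by simp [Branch.out_nil]⟩
      · simp at h
    | step _ x B y v hx _ ih =>
      rcases (hr _ _).1 hx with ⟨-, h⟩ | ⟨i, hi, rfl, h⟩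
      · simp at h
      · simp only [Option.some.injEq, Prod.mk.injEq] at h
        obtain ⟨rfl, rfl⟩ := h
        obtain ⟨I, hI, rfl⟩ := ih rfl
        exact ⟨i :: I, by simp [hi, hI], by simp [Branch.out_cons]⟩
  · rintro ⟨I, hI, rfl⟩
    induction I with
    | nil => exact .leaf _ _ ((hr _ _).2 (Or.inl (by simp [Branch.out_nil])))
    | cons i I ih =>
      simp only [List.cons_subset] at hI
      have := LinearGrammar.Derives.step (g := branchGrammar idx H) _ _ _ _ _
        ((hr _ _).2 (Or.inr ⟨i, hI.1, rfl, rfl⟩)) (ih hI.2)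
      simpa [Branch.out_cons] using this

/-- If the cut falls in the block of an index `i`, the indices before `i` contribute no output, `i`
contributes a prefix of `u i`, and the inner indices are expanded in full by `1 + b`. Cuts among the
indices or in `pre` are made by the terminating productions. -/
theorem derives_part {b : Bool} {w : List ℕ} :
    (branchGrammar idx H).Derives (3 + b.toNat) w ↔
      ∃ I, I ⊆ idx ∧ (w = I ∨ ∃ x, x <+: (H b).out I ∧ w = I ++ 2 :: x) := by
  have hr : ∀ x t, ⟨3 + b.toNat, x, t⟩ ∈ (branchGrammar idx H).rules ↔
      (x = [] ∧ t = none) ∨ (∃ y, y <+: (H b).pre ∧ x = 2 :: y ∧ t = none) ∨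
      (∃ i ∈ idx, x = [i] ∧ t = some (3 + b.toNat, [])) ∨
      ∃ i ∈ idx, ∃ y, y <+: (H b).u i ∧ x = [i] ∧ t = some (1 + b.toNat, y) := by
    intro x t
    cases b <;> simp [branchGrammar, Branch.fixedRules, preRules] <;> grind
  constructor
  · intro h
    generalize hA : 3 + b.toNat = A at h
    induction h with subst hA
    | leaf _ x hx =>
      rcases (hr _ _).1 hx with ⟨rfl, -⟩ | ⟨y, hy, rfl, -⟩ | ⟨i, -, -, h⟩ | ⟨i, -, y, -, -, h⟩
      · exact ⟨[], by simp, Or.inl rfl⟩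
      · exact ⟨[], by simp, Or.inr ⟨y, by simpa [Branch.out_nil] using hy, rfl⟩⟩
      · simp at h
      · simp at h
    | step _ x B y v hx hv ih =>
      rcases (hr _ _).1 hx with ⟨-, h⟩ | ⟨y, -, -, h⟩ | ⟨i, hi, rfl, h⟩ | ⟨i, hi, y, hy, rfl, h⟩
      · simp at h
      · simp at h
      · simp only [Option.some.injEq, Prod.mk.injEq] at h
        obtain ⟨rfl, rfl⟩ := h
        obtain ⟨I, hI, rfl | ⟨x, hx, rfl⟩⟩ := ih rfl
        · exact ⟨i :: v, by simp [hi, hI], Or.inl (by simp)⟩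
        · exact ⟨i :: I, by simp [hi, hI], Or.inr ⟨x, by
            rw [Branch.out_cons]; exact hx.trans (List.prefix_append _ _), by simp⟩⟩
      · simp only [Option.some.injEq, Prod.mk.injEq] at h
        obtain ⟨rfl, rfl⟩ := h
        obtain ⟨I, hI, rfl⟩ := derives_full.1 hv
        exact ⟨i :: I, by simp [hi, hI], Or.inr ⟨(H b).out I ++ y, by
            rw [Branch.out_cons, List.prefix_append_right_inj]; exact hy, by simp⟩⟩
  · rintro ⟨I, hI, h⟩
    induction I generalizing w with
    | nil =>
      rcases h with rfl | ⟨x, hx, rfl⟩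
      · exact .leaf _ _ ((hr _ _).2 (Or.inl ⟨rfl, rfl⟩))
      · exact .leaf _ _ ((hr _ _).2 (Or.inr (Or.inl
          ⟨x, by simpa [Branch.out_nil] using hx, rfl, rfl⟩)))
    | cons i I ih =>
      simp only [List.cons_subset] at hI
      have hs := fun v hv => LinearGrammar.Derives.step (g := branchGrammar idx H) _ _ _ _ v
        ((hr _ _).2 (Or.inr (Or.inr (Or.inl ⟨i, hI.1, rfl, rfl⟩)))) hv
      rcases h with rfl | ⟨x, hx, rfl⟩
      · simpa using hs _ (ih hI.2 (Or.inl rfl))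
      · rw [Branch.out_cons, prefix_append_iff] at hx
        rcases hx with hx | ⟨y, hy, rfl⟩
        · simpa using hs _ (ih hI.2 (Or.inr ⟨x, hx, rfl⟩))
        · have := LinearGrammar.Derives.step (g := branchGrammar idx H) _ _ _ _ _
            ((hr _ _).2 (Or.inr (Or.inr (Or.inr ⟨i, hI.1, y, hy, rfl, rfl⟩))))
            (derives_full.2 ⟨I, hI.2, rfl⟩)
          simpa using this

theorem language_branchGrammar :
    (branchGrammar idx H).language = branchLanguage idx H := by
  have hr : ∀ x t, ⟨0, x, t⟩ ∈ (branchGrammar idx H).rules ↔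
      (x = [] ∧ t = none) ∨ ∃ b : Bool, x = [b.toNat] ∧ (t = some (3 + b.toNat, []) ∨
        ∃ y, y <+: (H b).post ++ [3 + b.toNat] ∧ t = some (1 + b.toNat, y)) := by
    intro x t
    simp [branchGrammar, Branch.fixedRules, preRules, -List.inits_append]
    grind
  ext w
  rw [LinearGrammar.mem_language_iff, LinearGrammar.derives_iff]
  change ((⟨0, _, _⟩ : LinearRule) ∈ _ ∨ ∃ x B y v, (⟨0, _, _⟩ : LinearRule) ∈ _ ∧ _) ↔ _ ∨ _
  simp only [hr]
  constructor
  · rintro ((⟨rfl, -⟩ | ⟨b, -, h | ⟨y, -, h⟩⟩) | ⟨x, B, y, v, ⟨-, h⟩ | ⟨b, rfl, h | ⟨y, hy, h⟩⟩, hv, rfl⟩)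
    · exact Or.inl rfl
    · simp at h
    · simp at h
    · simp at h
    · simp only [Option.some.injEq, Prod.mk.injEq] at h
      obtain ⟨rfl, rfl⟩ := h
      obtain ⟨I, hI, rfl | ⟨x, hx, rfl⟩⟩ := derives_part.1 hv
      · exact Or.inr ⟨b, v, hI, Or.inl (by simp)⟩
      · exact Or.inr ⟨b, I, hI, Or.inr ⟨x, hx.trans (List.prefix_append _ _), by simp⟩⟩
    · simp only [Option.some.injEq, Prod.mk.injEq] at h
      obtain ⟨rfl, rfl⟩ := h
      obtain ⟨I, hI, rfl⟩ := derives_full.1 hv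
      exact Or.inr ⟨b, I, hI, Or.inr ⟨(H b).out I ++ y, by
        rw [List.prefix_append_right_inj]; exact hy, by simp⟩⟩
  · rintro (rfl | ⟨b, I, hI, h⟩)
    · simp
    · right
      rcases h with rfl | ⟨x, hx, rfl⟩
      · exact ⟨_, _, _, _, Or.inr ⟨b, rfl, Or.inl rfl⟩, derives_part.2 ⟨I, hI, Or.inl rfl⟩, by simp⟩
      · rcases prefix_append_iff.1 hx with hx | ⟨y, hy, rfl⟩
        · exact ⟨_, _, _, _, Or.inr ⟨b, rfl, Or.inl rfl⟩,
            derives_part.2 ⟨I, hI, Or.inr ⟨x, hx, rfl⟩⟩, by simp⟩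
        · exact ⟨_, _, _, _, Or.inr ⟨b, rfl, Or.inr ⟨y, hy, rfl⟩⟩,
            derives_full.2 ⟨I, hI, rfl⟩, by simp⟩

end

/-! ### The pushdown automaton -/

/-- The moves of branch `b`, except the one that depends on `pre`. -/
def Branch.fixedMoves (h : Branch) (idx : List ℕ) (b : Bool) : List Move :=
  ⟨0, some b.toNat, 0, 1 + b.toNat, 0 :: (h.post ++ [3 + b.toNat])⟩ ::
  idx.map fun i => ⟨1 + b.toNat, some i, 0, 1 + b.toNat, 0 :: h.u i⟩

/-- The move of branch `b` that depends on `pre`. -/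
def preMove (pre : List ℕ) (b : Bool) : Move :=
  ⟨1 + b.toNat, some 2, 0, 5, pre⟩

/-- A real-time deterministic pushdown automaton for `branchLanguage idx H`, over the alphabet
`{0, …, N - 1}`. -/
def branchPDA (N : ℕ) (idx : List ℕ) (H : Bool → Branch) : PDA where
  start := 0
  -- The bottom symbol `0` doubles as a marker that stays on top until the separator is read. All
  -- states in use are accepting, as suits a prefix-closed language.
  bottom := 0
  final := [0, 1, 2, 5]
  moves := (((H false).fixedMoves idx false ++ (H true).fixedMoves idx true ++
    (List.range N).map (fun x => ⟨5, some x, x, 5, []⟩)) ++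
    [preMove (H false).pre false]) ++ [preMove (H true).pre true]

section

variable {N : ℕ} {idx : List ℕ} {H : Bool → Branch}

theorem mem_branchPDA_moves {m : Move} : m ∈ (branchPDA N idx H).moves ↔
    (∃ b : Bool, m = ⟨0, some b.toNat, 0, 1 + b.toNat, 0 :: ((H b).post ++ [3 + b.toNat])⟩) ∨
    (∃ b : Bool, ∃ i ∈ idx, m = ⟨1 + b.toNat, some i, 0, 1 + b.toNat, 0 :: (H b).u i⟩) ∨
    (∃ x < N, m = ⟨5, some x, x, 5, []⟩) ∨
    ∃ b : Bool, m = ⟨1 + b.toNat, some 2, 0, 5, (H b).pre⟩ := by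
  simp only [branchPDA, Branch.fixedMoves, preMove, List.mem_append, List.mem_cons, List.mem_map,
    List.mem_range, List.not_mem_nil, or_false, Bool.exists_bool, eq_comm (a := m)]
  grind

theorem branchPDA_input : ∀ m ∈ (branchPDA N idx H).moves, m.input ≠ none := by
  intro m hm
  rcases mem_branchPDA_moves.1 hm with ⟨b, rfl⟩ | ⟨b, i, -, rfl⟩ | ⟨x, -, rfl⟩ | ⟨b, rfl⟩ <;> simp

/-- The only possible clash is between an index move and the separator move in state `1 + b`, which
`2 ∉ idx` excludes. -/
theorem branchPDA_isDeterministic (h2 : 2 ∉ idx) : (branchPDA N idx H).IsDeterministic := by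
  intro m hm m' hm' hs ht hi
  replace hi : m.input = m'.input := hi.resolve_right (branchPDA_input m hm)
  have hb : ∀ b b' : Bool, b.toNat = b'.toNat → b = b' := by decide
  have hle := Bool.toNat_le
  rcases mem_branchPDA_moves.1 hm with ⟨b, rfl⟩ | ⟨b, i, h, rfl⟩ | ⟨x, h, rfl⟩ | ⟨b, rfl⟩ <;>
  rcases mem_branchPDA_moves.1 hm' with ⟨b', rfl⟩ | ⟨b', i', h', rfl⟩ | ⟨x', h', rfl⟩ | ⟨b', rfl⟩ <;>
  simp only [Option.some.injEq] at hs ht hi <;> grind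

/-- State `5` compares the input with the stack letter by letter and may stop anywhere. Pop moves
exist only for symbols below `N`, hence the bound on the stack. -/
theorem accepts_pop {w β : List ℕ} (hβ : ∀ x ∈ β, x < N) :
    (branchPDA N idx H).Accepts 5 w β ↔ w <+: β := by
  have hr : ∀ a t q p, ⟨5, a, t, q, p⟩ ∈ (branchPDA N idx H).moves ↔
      t < N ∧ a = some t ∧ q = 5 ∧ p = [] := by
    intro a t q p
    simp [branchPDA, Branch.fixedMoves, preMove]
    grind
  induction w generalizing β with
  | nil => rw [PDA.accepts_nil branchPDA_input]; simp [branchPDA]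
  | cons a w ih =>
    rw [PDA.accepts_cons branchPDA_input]
    simp only [hr]
    constructor
    · rintro ⟨t, β', rfl, q', p, ⟨-, ha, rfl, rfl⟩, h⟩
      cases ha
      simpa using (ih fun x hx => hβ x (List.mem_cons_of_mem _ hx)).1 h
    · intro h
      rcases β with _ | ⟨t, β⟩
      · simp at h
      · obtain ⟨rfl, h'⟩ := List.cons_prefix_cons.1 h
        exact ⟨a, β, rfl, 5, [], ⟨hβ a (by simp), rfl, rfl, rfl⟩,
          (ih (β := β) fun x hx => hβ x (List.mem_cons_of_mem _ hx)).2 h'⟩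

/-- The word of a later index lies above those of earlier ones and is popped sooner, in agreement
with the reversal in `out`. The separator replaces the marker by `pre`, which is popped before all
of them. -/
theorem accepts_push {b : Bool} {w β : List ℕ} (hβ : ∀ x ∈ β, x < N)
    (hpre : ∀ x ∈ (H b).pre, x < N) (hu : ∀ i ∈ idx, ∀ x ∈ (H b).u i, x < N) :
    (branchPDA N idx H).Accepts (1 + b.toNat) w (0 :: β) ↔
      ∃ I, I ⊆ idx ∧ (w = I ∨ ∃ x, x <+: (H b).out I ++ β ∧ w = I ++ 2 :: x) := by
  have hr : ∀ a t q p, ⟨1 + b.toNat, some a, t, q, p⟩ ∈ (branchPDA N idx H).moves ↔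
      (t = 0 ∧ a ∈ idx ∧ q = 1 + b.toNat ∧ p = 0 :: (H b).u a) ∨
      (t = 0 ∧ a = 2 ∧ q = 5 ∧ p = (H b).pre) := by
    intro a t q p
    cases b <;> simp [branchPDA, Branch.fixedMoves, preMove] <;> grind
  induction w generalizing β with
  | nil =>
    rw [PDA.accepts_nil branchPDA_input]
    constructor
    · exact fun _ => ⟨[], by simp, Or.inl rfl⟩
    · intro _; cases b <;> simp [branchPDA]
  | cons a w ih =>
    rw [PDA.accepts_cons branchPDA_input]
    simp only [hr]
    constructor
    · rintro ⟨t, β', h, q', p, ⟨rfl, ha, rfl, rfl⟩ | ⟨rfl, rfl, rfl, rfl⟩, hacc⟩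
      · cases h
        obtain ⟨I, hI, h⟩ := (ih (List.forall_mem_append.2 ⟨hu a ha, hβ⟩)).1 hacc
        refine ⟨a :: I, by simp [ha, hI], ?_⟩
        simpa [Branch.out_cons] using h
      · cases h
        rw [accepts_pop (List.forall_mem_append.2 ⟨hpre, hβ⟩)] at hacc
        exact ⟨[], by simp, Or.inr ⟨w, by simpa [Branch.out_nil] using hacc, rfl⟩⟩
    · rintro ⟨I, hI, h⟩
      rcases I with _ | ⟨i, I⟩
      · rcases h with h | ⟨x, hx, h⟩
        · simp at h
        · simp only [List.nil_append, List.cons.injEq] at h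
          obtain ⟨rfl, rfl⟩ := h
          refine ⟨0, β, rfl, 5, _, Or.inr ⟨rfl, rfl, rfl, rfl⟩, ?_⟩
          rw [accepts_pop (List.forall_mem_append.2 ⟨hpre, hβ⟩)]
          simpa [Branch.out_nil] using hx
      · simp only [List.cons_append, List.cons.injEq] at h
        have hai : a = i := by rcases h with h | ⟨x, -, h⟩ <;> exact h.1
        subst hai
        simp only [List.cons_subset] at hI
        refine ⟨0, β, rfl, 1 + b.toNat, _, Or.inl ⟨rfl, hI.1, rfl, rfl⟩, ?_⟩
        refine (ih (List.forall_mem_append.2 ⟨hu a hI.1, hβ⟩)).2 ⟨I, hI.2, ?_⟩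
        simpa [Branch.out_cons] using h

theorem language_branchPDA (hN : 4 < N) (hpre : ∀ b, ∀ x ∈ (H b).pre, x < N)
    (hpost : ∀ b, ∀ x ∈ (H b).post, x < N) (hu : ∀ b, ∀ i ∈ idx, ∀ x ∈ (H b).u i, x < N) :
    (branchPDA N idx H).language = branchLanguage idx H := by
  have hr : ∀ a t q p, ⟨0, some a, t, q, p⟩ ∈ (branchPDA N idx H).moves ↔
      ∃ b : Bool, t = 0 ∧ a = b.toNat ∧ q = 1 + b.toNat ∧
        p = 0 :: ((H b).post ++ [3 + b.toNat]) := by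
    intro a t q p
    simp [branchPDA, Branch.fixedMoves, preMove]
    grind
  ext w
  change (branchPDA N idx H).Accepts 0 w [0] ↔ _ ∨ _
  rcases w with _ | ⟨a, w⟩
  · rw [PDA.accepts_nil branchPDA_input]; simp [branchPDA]
  · rw [PDA.accepts_cons branchPDA_input]
    simp only [hr]
    have hacc : ∀ b, (branchPDA N idx H).Accepts (1 + b.toNat) w
        (0 :: ((H b).post ++ [3 + b.toNat])) ↔ _ := fun b => accepts_push (by
      have := hpost b
      have : b.toNat ≤ 1 := Bool.toNat_le b
      simp only [List.mem_append, List.mem_singleton]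
      rintro x (hx | rfl)
      · exact hpost b x hx
      · omega) (hpre b) (hu b)
    constructor
    · rintro ⟨t, β, h, q, p, ⟨b, rfl, rfl, rfl, rfl⟩, h'⟩
      cases h
      rw [List.append_nil, hacc] at h'
      obtain ⟨I, hI, h'⟩ := h'
      exact Or.inr ⟨b, I, hI, by simpa using h'⟩
    · rintro (h | ⟨b, I, hI, h⟩)
      · simp at h
      · simp only [List.cons_append, List.cons.injEq] at h
        have hab : a = b.toNat := by rcases h with h | ⟨x, -, h⟩ <;> exact h.1
        subst hab
        refine ⟨0, [], rfl, _, _, ⟨b, rfl, rfl, rfl, rfl⟩, ?_⟩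
        rw [List.append_nil, hacc]
        exact ⟨I, hI, by simpa using h⟩

end

/-! ### Observation consistency of the two-branch languages -/

theorem proj_append {α : Type*} (S : Set α) (v w : List α) :
    proj S (v ++ w) = proj S v ++ proj S w := by
  simp [proj]

theorem proj_eq_self {α : Type*} {S : Set α} {w : List α} (h : ∀ a ∈ w, a ∈ S) :
    proj S w = w := by
  simpa [proj] using h

theorem proj_eq_nil {α : Type*} {S : Set α} {w : List α} (h : ∀ a ∈ w, a ∉ S) :
    proj S w = [] := by
  simpa [proj] using h

/-- The complete word of branch `b` given by a word of indices. -/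
def fullWord (H : Bool → Branch) (b : Bool) (I : List ℕ) : List ℕ :=
  b.toNat :: I ++ 2 :: ((H b).out I ++ ((H b).post ++ [3 + b.toNat]))

/-- The observable letters. -/
def obsLetters (N : ℕ) : List ℕ :=
  (List.range N).filter fun x => x = 2 ∨ 5 ≤ x

section

variable {N : ℕ} {idx : List ℕ} {H : Bool → Branch}

theorem fullWord_mem {b : Bool} {I : List ℕ} (hI : I ⊆ idx) :
    fullWord H b I ∈ branchLanguage idx H :=
  Or.inr ⟨b, I, hI, Or.inr ⟨_, List.prefix_rfl, rfl⟩⟩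

/-- The letters that a branch uses lie between `5` and `N`. -/
structure Bounded (N : ℕ) (idx : List ℕ) (H : Bool → Branch) : Prop where
  four_lt : 4 < N
  idx_mem : ∀ i ∈ idx, 5 ≤ i ∧ i < N
  pre_mem : ∀ b, ∀ x ∈ (H b).pre, 5 ≤ x ∧ x < N
  post_mem : ∀ b, ∀ x ∈ (H b).post, 5 ≤ x ∧ x < N
  u_mem : ∀ b, ∀ i ∈ idx, ∀ x ∈ (H b).u i, 5 ≤ x ∧ x < N

theorem Bounded.out_mem (h : Bounded N idx H) {b : Bool} {I : List ℕ} (hI : I ⊆ idx) :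
    ∀ x ∈ (H b).out I, 5 ≤ x ∧ x < N := by
  intro x hx
  simp only [Branch.out, List.mem_append, List.mem_flatMap, List.mem_reverse] at hx
  rcases hx with hx | ⟨i, hi, hx⟩
  · exact h.pre_mem b x hx
  · exact h.u_mem b i (hI hi) x hx

theorem mem_obsLetters {x : ℕ} : x ∈ obsLetters N ↔ x < N ∧ (x = 2 ∨ 5 ≤ x) := by
  simp [obsLetters]

theorem proj_high_fullWord (h : Bounded N idx H) {b : Bool} {I : List ℕ} (hI : I ⊆ idx) :
    proj {a | a ∈ [3, 4]} (fullWord H b I) = [3 + b.toNat] := by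
  have e : fullWord H b I =
      (b.toNat :: (I ++ 2 :: ((H b).out I ++ (H b).post))) ++ [3 + b.toNat] := by
    simp [fullWord]
  have := Bool.toNat_le b
  rw [e, proj_append, proj_eq_nil, proj_eq_self, List.nil_append]
  · cases b <;> simp
  · simp only [List.mem_cons, List.mem_append, Set.mem_ofPred_eq, List.not_mem_nil, or_false]
    rintro a (rfl | ha | rfl | ha | ha)
    · omega
    · have := h.idx_mem a (hI ha); omega
    · omega
    · have := h.out_mem hI a ha; omega
    · have := h.post_mem b a ha; omega

theorem proj_obs_fullWord (h : Bounded N idx H) {b : Bool} {I : List ℕ} (hI : I ⊆ idx) :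
    proj {a | a ∈ obsLetters N} (fullWord H b I) = I ++ 2 :: ((H b).out I ++ (H b).post) := by
  have e : fullWord H b I =
      [b.toNat] ++ (I ++ 2 :: ((H b).out I ++ (H b).post)) ++ [3 + b.toNat] := by
    simp [fullWord]
  have := Bool.toNat_le b
  rw [e, proj_append, proj_append, proj_eq_nil, proj_eq_self, proj_eq_nil, List.nil_append,
    List.append_nil]
  · simp [mem_obsLetters]; omega
  · simp only [List.mem_cons, List.mem_append, Set.mem_ofPred_eq, mem_obsLetters]
    have := h.four_lt
    rintro a (ha | rfl | ha | ha)
    · have := h.idx_mem a (hI ha); omega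
    · omega
    · have := h.out_mem hI a ha; omega
    · have := h.post_mem b a ha; omega
  · simp [mem_obsLetters]; omega

/-- Only the complete words have a high-level letter. -/
theorem proj_high_eq_nil_or (h : Bounded N idx H) {w : List ℕ} (hw : w ∈ branchLanguage idx H) :
    proj {a | a ∈ [3, 4]} w = [] ∨ ∃ b I, I ⊆ idx ∧ w = fullWord H b I := by
  have key : ∀ (b : Bool) (I y : List ℕ), I ⊆ idx → (∀ a ∈ y, a = 2 ∨ 5 ≤ a) →
      proj {a | a ∈ [3, 4]} (b.toNat :: I ++ y) = [] := by
    intro b I y hI hy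
    have := Bool.toNat_le b
    refine proj_eq_nil ?_
    simp only [List.mem_cons, List.mem_append, Set.mem_ofPred_eq, List.not_mem_nil, or_false]
    rintro a ((rfl | ha) | ha)
    · omega
    · have := h.idx_mem a (hI ha); omega
    · have := hy a ha; omega
  rcases hw with rfl | ⟨b, I, hI, rfl | ⟨x, hx, rfl⟩⟩
  · exact Or.inl (by simp [proj])
  · exact Or.inl (by simpa using key b I [] hI (by simp))
  · rw [← List.append_assoc, List.prefix_concat_iff] at hx
    rcases hx with rfl | hx
    · exact Or.inr ⟨b, I, hI, by simp [fullWord]⟩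
    · refine Or.inl (key b I _ hI ?_)
      simp only [List.mem_cons]
      rintro a (rfl | ha)
      · exact Or.inl rfl
      · rcases List.mem_append.1 (hx.subset ha) with ha | ha
        · exact Or.inr (h.out_mem hI a ha).1
        · exact Or.inr (h.post_mem b a ha).1

/-- The high-level images are `[]`, `[3]` and `[4]`, and all have the same P_hi-image. Preimages of
`[3]` and `[4]` are complete words of the two branches; the separator `2` splits their observations,
so equality forces the same `I` and the same product. Conversely one such `I` yields preimages of
all three images with a single common observation. -/
theorem observationConsistent_branchLanguage_iff (h : Bounded N idx H) :
    ObservationConsistent {a | a ∈ [3, 4]} {a | a ∈ obsLetters N} (branchLanguage idx H) ↔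
      ∃ I, I ⊆ idx ∧
        (H false).out I ++ (H false).post = (H true).out I ++ (H true).post := by
  constructor
  · intro hoc
    have him : ∀ b : Bool, [3 + b.toNat] ∈
        proj {a | a ∈ [3, 4]} '' (branchLanguage idx H : Set (List ℕ)) := fun b =>
      ⟨fullWord H b [], fullWord_mem (by simp), proj_high_fullWord h (by simp)⟩
    obtain ⟨s, hs, s', hs', hA, hA', hP⟩ := hoc _ (him false) _ (him true) (by
      have : ∀ a, ¬ ((a = 3 ∨ a = 4) ∧ a ∈ obsLetters N) := by
        intro a
        rw [mem_obsLetters]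
        omega
      rw [proj_eq_nil, proj_eq_nil] <;> intro a _ ha <;> exact this a (by simpa using ha))
    have hfull : ∀ (b : Bool) (w : List ℕ), w ∈ branchLanguage idx H →
        proj {a | a ∈ [3, 4]} w = [3 + b.toNat] → ∃ I, I ⊆ idx ∧ w = fullWord H b I := by
      intro b w hw hA
      rcases proj_high_eq_nil_or h hw with h0 | ⟨b', I, hI, rfl⟩
      · rw [h0] at hA
        simp at hA
      · rw [proj_high_fullWord h hI] at hA
        cases b <;> cases b' <;> simp at hA <;> exact ⟨I, hI, rfl⟩
    obtain ⟨I, hI, rfl⟩ := hfull false s hs hA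
    obtain ⟨I', hI', rfl⟩ := hfull true s' hs' hA'
    rw [proj_obs_fullWord h hI, proj_obs_fullWord h hI'] at hP
    have h2 : ∀ (b : Bool) (J : List ℕ), J ⊆ idx → ∀ x ∈ (H b).out J ++ (H b).post, ¬ x = 2 := by
      intro b J hJ x hx
      rcases List.mem_append.1 hx with hx | hx
      · have := h.out_mem hJ x hx; omega
      · have := h.post_mem b x hx; omega
    obtain ⟨rfl, -, hX⟩ := append_cons_inj_of_pred (· = 2) rfl
      (fun a ha => by have := h.idx_mem a (hI ha); omega) (h2 false I hI) hP
    exact ⟨I, hI, hX⟩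
  · rintro ⟨I, hI, hX⟩
    have hw : ∀ t ∈ proj {a | a ∈ [3, 4]} '' (branchLanguage idx H : Set (List ℕ)),
        ∃ s ∈ branchLanguage idx H, proj {a | a ∈ [3, 4]} s = t ∧
          proj {a | a ∈ obsLetters N} s = I ++ 2 :: ((H false).out I ++ (H false).post) := by
      rintro t ⟨w, hw, rfl⟩
      rcases proj_high_eq_nil_or h hw with h0 | ⟨b, J, hJ, rfl⟩
      · rw [h0]
        -- Dropping the unobservable closing letter leaves the observation unchanged and makes the
        -- high-level image empty.
        refine ⟨false.toNat :: I ++ 2 :: ((H false).out I ++ (H false).post),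
          Or.inr ⟨false, I, hI, Or.inr ⟨_, ?_, rfl⟩⟩, ?_, ?_⟩
        · rw [← List.append_assoc]
          exact List.prefix_append _ _
        · have := proj_high_fullWord h (b := false) hI
          have e : fullWord H false I = (false.toNat :: I ++
            2 :: ((H false).out I ++ (H false).post)) ++ [3 + false.toNat] := by simp [fullWord]
          rw [e, proj_append, proj_eq_self (w := [3 + false.toNat]) (by simp)] at this
          simpa using this
        · have := proj_obs_fullWord h (b := false) hI
          have e : fullWord H false I = (false.toNat :: I ++
            2 :: ((H false).out I ++ (H false).post)) ++ [3 + false.toNat] := by simp [fullWord]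
          rw [e, proj_append, proj_eq_nil (w := [3 + false.toNat]) (by simp [mem_obsLetters])]
            at this
          simpa using this
      · refine ⟨fullWord H b I, fullWord_mem hI, ?_, ?_⟩
        · rw [proj_high_fullWord h hI, proj_high_fullWord h hJ]
        · rw [proj_obs_fullWord h hI]
          cases b
          · rfl
          · rw [hX]
    intro t ht t' ht' _
    obtain ⟨s, hs, hA, hP⟩ := hw t ht
    obtain ⟨s', hs', hA', hP'⟩ := hw t' ht'
    exact ⟨s, hs, s', hs', hA, hA', hP.trans hP'.symm⟩

/-! ### The instance -/

/-- The instance of the decision problem given by two branches. -/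
def branchInstance (N : ℕ) (idx : List ℕ) (H : Bool → Branch) : Instance where
  alphabet := List.range N
  high := [3, 4]
  obs := obsLetters N
  grammar := branchGrammar idx H
  automaton := branchPDA N idx H

theorem branchInstance_isObservationConsistent_iff (h : Bounded N idx H) :
    (branchInstance N idx H).IsObservationConsistent ↔ ∃ I, I ⊆ idx ∧
      (H false).out I ++ (H false).post = (H true).out I ++ (H true).post := by
  rw [← observationConsistent_branchLanguage_iff h, ← language_branchGrammar]
  rfl

theorem branchInstance_admissible (h : Bounded N idx H) :
    (branchInstance N idx H).Admissible where
  high_ne := by simp [branchInstance]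
  obs_ne := by
    have := h.four_lt
    exact List.ne_nil_of_mem (a := 2) (mem_obsLetters.2 ⟨by omega, Or.inl rfl⟩)
  high_sub := by
    have := h.four_lt
    simp only [branchInstance, List.cons_subset, List.mem_range, List.nil_subset, and_true]
    omega
  obs_sub := List.filter_subset_self _
  grammar_letters := by
    have hN := h.four_lt
    have hidx := h.idx_mem
    intro r hr x hx
    have hpre : ∀ b, ∀ y, y <+: (H b).pre → ∀ x ∈ y, x < N := fun b y hy x hx =>
      (h.pre_mem b x (hy.subset hx)).2
    have hpost : ∀ b : Bool, ∀ y, y <+: (H b).post ++ [3 + b.toNat] → ∀ x ∈ y, x < N := by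
      intro b y hy x hx
      have := Bool.toNat_le b
      rcases List.mem_append.1 (hy.subset hx) with hx | hx
      · exact (h.post_mem b x hx).2
      · simp at hx; omega
    have hu : ∀ b, ∀ i ∈ idx, ∀ y, y <+: (H b).u i → ∀ x ∈ y, x < N := fun b i hi y hy x hx =>
      (h.u_mem b i hi x (hy.subset hx)).2
    change x ∈ List.range N
    rw [List.mem_range]
    have hfix : ∀ b, r ∈ (H b).fixedRules idx b → x < N := by
      intro b hr
      have := Bool.toNat_le b
      simp only [Branch.fixedRules, List.mem_append, List.mem_cons, List.mem_map,
        List.mem_flatMap, List.mem_inits] at hr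
      rcases hr with (((rfl | ⟨y, hy, rfl⟩) | ⟨i, hi, rfl⟩) | rfl | ⟨i, hi, rfl⟩) |
        ⟨i, hi, y, hy, rfl⟩
      all_goals simp only [LinearRule.letters, List.mem_append, List.mem_singleton,
        List.not_mem_nil, or_false] at hx
      · omega
      · rcases hx with rfl | hx
        · omega
        · exact hpost b y hy x hx
      · rcases hx with rfl | hx
        · exact (hidx _ hi).2
        · exact hu b i hi _ List.prefix_rfl x hx
      · subst hx
        exact (hidx _ hi).2
      · rcases hx with rfl | hx
        · exact (hidx _ hi).2
        · exact hu b i hi _ hy x hx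
    have hpr : ∀ b, r ∈ preRules (H b).pre b → x < N := by
      intro b hr
      simp only [preRules, List.mem_cons, List.mem_map, List.mem_inits] at hr
      rcases hr with rfl | ⟨y, hy, rfl⟩
      all_goals simp only [LinearRule.letters, List.mem_append, List.mem_cons,
        List.not_mem_nil, or_false] at hx
      · rcases hx with rfl | hx
        · omega
        · exact hpre b _ List.prefix_rfl x hx
      · rcases hx with rfl | hx
        · omega
        · exact hpre b y hy x hx
    simp only [branchInstance, branchGrammar, List.mem_append, List.mem_cons] at hr
    rcases hr with ((((rfl | hr) | hr) | hr) | hr)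
    · simp [LinearRule.letters] at hx
    · exact hfix _ hr
    · exact hfix _ hr
    · exact hpr _ hr
    · exact hpr _ hr
  automaton_letters := by
    have hN := h.four_lt
    intro m hm a ha
    change a ∈ List.range N
    rw [List.mem_range]
    rcases mem_branchPDA_moves.1 hm with ⟨b, rfl⟩ | ⟨b, i, hi, rfl⟩ | ⟨x, hx, rfl⟩ | ⟨b, rfl⟩
    all_goals simp only [Option.mem_def, Option.some.injEq] at ha; subst ha
    · have := Bool.toNat_le b; omega
    · exact (h.idx_mem _ hi).2
    · exact hx
    · omega
  deterministic := branchPDA_isDeterministic fun h2 => by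
    have := h.idx_mem 2 h2
    omega
  same_language := by
    refine Eq.trans ?_ language_branchGrammar.symm
    exact language_branchPDA h.four_lt (fun b x hx => (h.pre_mem b x hx).2)
      (fun b x hx => (h.post_mem b x hx).2) (fun b i hi x hx => (h.u_mem b i hi x hx).2)
  prefixClosed := by
    have := isPrefixClosed_branchLanguage idx H
    rwa [← language_branchGrammar] at this

end

/-! ### String rewriting and tilings -/

/-- One application of a rule of a string rewriting system. -/
inductive Rewrite {α : Type*} (R : Set (List α × List α)) : List α → List α → Prop
  | mk (x y l r : List α) : (l, r) ∈ R → Rewrite R (x ++ l ++ y) (x ++ r ++ y)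

section

variable {α : Type*}

/-- The tiles of a rewriting system: a separator, a copying tile for each letter, and the rules. -/
def tiles (A : List α) (R : List (List α × List α)) :
    List (List (Option α) × List (Option α)) :=
  ([none], [none]) :: A.map (fun a => ([some a], [some a])) ++
    R.map (Prod.map (List.map some) (List.map some))

/-- The current word is `y ++ w`: in the present pass `y` has been output and `w` is still to be
read. A copying or rule tile takes its top off `w` and appends its bottom to `y`. Its top has no
separator, so it cannot reach beyond `w`. -/
theorem rewrites_of_tiling {A : List α} {R : List (List α × List α)} {f : List α}
    {J : List (List (Option α) × List (Option α))} (hJ : J ⊆ tiles A R) {w y : List α}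
    (h : J.flatMap Prod.fst ++ none :: f.map some =
      w.map some ++ none :: (y.map some ++ J.flatMap Prod.snd)) :
    Relation.ReflTransGen (Rewrite {p | p ∈ R}) (y ++ w) f := by
  have hs : ∀ l : List α, ∀ b ∈ l.map some, ¬ b = none := by simp
  induction J generalizing w y with
  | nil =>
    simp only [List.flatMap_nil, List.append_nil] at h
    obtain ⟨h1, -, h2⟩ := append_cons_inj_of_pred (· = none) (x := []) rfl (by simp) (hs f) h
    obtain rfl : w = [] := by simpa using h1.symm
    obtain rfl := List.map_injective_iff.2 (Option.some_injective α) h2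
    simpa using .refl
  | cons p J ih =>
    simp only [List.cons_subset] at hJ
    have hstep : ∀ l r : List α, p = (l.map some, r.map some) →
        ∃ w', w = l ++ w' ∧ Relation.ReflTransGen (Rewrite {p | p ∈ R}) (y ++ r ++ w') f := by
      rintro l r rfl
      simp only [List.flatMap_cons, List.append_assoc] at h
      have hl : l.map some <+: w.map some := by
        rcases List.append_eq_append_iff.1 h with ⟨z, h1, -⟩ | ⟨z, h1, h2⟩
        · exact ⟨z, h1.symm⟩
        · rcases z with _ | ⟨c, z⟩
          · rw [h1]; simp
          · simp only [List.cons_append, List.cons.injEq] at h2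
            exact absurd h2.1.symm (hs l c (by rw [h1]; simp))
      obtain ⟨w', rfl⟩ : l <+: w := by
        obtain ⟨z, hz⟩ := hl
        obtain ⟨l', w', rfl, h1, rfl⟩ := List.map_eq_append_iff.1 hz.symm
        obtain rfl := List.map_injective_iff.2 (Option.some_injective α) h1
        exact List.prefix_append _ _
      exact ⟨w', rfl, ih hJ.2 (by simpa using h)⟩
    have hp := hJ.1
    simp only [tiles, List.mem_append, List.mem_cons, List.mem_map] at hp
    rcases hp with ((rfl | ⟨a, -, rfl⟩) | ⟨⟨l, r⟩, hlr, rfl⟩)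
    -- A separator tile fits only when `w` is used up; `y` is then the word to read in the next
    -- pass.
    · rcases w with _ | ⟨a, w⟩
      · have := ih hJ.2 (w := y) (y := []) (by simpa using h)
        simpa using this
      · simp at h
    · obtain ⟨w', rfl, h'⟩ := hstep [a] [a] rfl
      simpa using h'
    · obtain ⟨w', rfl, h'⟩ := hstep l r rfl
      rw [← List.append_assoc]
      exact .head (.mk y w' l r hlr) h'

/-- Each rewriting step becomes one pass: copy `x`, use the rule, copy `y`, place a separator. The
last pass copies `f`, to match the `f` appended to the tops. -/
theorem exists_tiling_of_rewrites {A : List α} (hA : ∀ a, a ∈ A) {R : List (List α × List α)}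
    {f w : List α} (h : Relation.ReflTransGen (Rewrite {p | p ∈ R}) w f) :
    ∃ J, J ⊆ tiles A R ∧ J.flatMap Prod.fst ++ none :: f.map some =
      w.map some ++ none :: J.flatMap Prod.snd := by
  set c : α → List (Option α) × List (Option α) := fun a => ([some a], [some a]) with hc
  have hc1 : ∀ x : List α, (x.map c).flatMap Prod.fst = x.map some := by
    intro x
    induction x with
    | nil => rfl
    | cons a x ih => simp only [List.map_cons, List.flatMap_cons, ih]; rfl
  have hc2 : ∀ x : List α, (x.map c).flatMap Prod.snd = x.map some := by
    intro x
    induction x with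
    | nil => rfl
    | cons a x ih => simp only [List.map_cons, List.flatMap_cons, ih]; rfl
  have hcA : ∀ x : List α, x.map c ⊆ tiles A R := by
    intro x p hp
    obtain ⟨a, -, rfl⟩ := List.mem_map.1 hp
    simp [tiles, hc, hA]
  induction h using Relation.ReflTransGen.head_induction_on with
  | refl => exact ⟨f.map c, hcA f, by rw [hc1, hc2]⟩
  | head h _ ih =>
    obtain ⟨x, y, l, r, hlr⟩ := h
    obtain ⟨J, hJ, e⟩ := ih
    refine ⟨x.map c ++ ((l.map some, r.map some) :: (y.map c ++ ([none], [none]) :: J)), ?_, ?_⟩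
    · simp only [List.append_subset, List.cons_subset]
      refine ⟨hcA x, ?_, hcA y, by simp [tiles], hJ⟩
      simp only [tiles, List.mem_append, List.mem_map]
      exact Or.inr ⟨_, hlr, rfl⟩
    · simp only [List.flatMap_append, List.flatMap_cons, hc1, hc2, List.append_assoc, e]
      simp

theorem exists_tiling_iff {A : List α} (hA : ∀ a, a ∈ A) {R : List (List α × List α)}
    {f w : List α} : (∃ J, J ⊆ tiles A R ∧ J.flatMap Prod.fst ++ none :: f.map some =
      w.map some ++ none :: J.flatMap Prod.snd) ↔
      Relation.ReflTransGen (Rewrite {p | p ∈ R}) w f :=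
  ⟨fun ⟨_, hJ, h⟩ => by simpa using rewrites_of_tiling hJ (y := []) (by simpa using h),
    exists_tiling_of_rewrites hA⟩

/-! ### From rewriting to the two-branch languages -/

variable [Encodable α]

/-- The code of a letter or of a tile. -/
def letterCode {β : Type*} [Encodable β] (b : β) : ℕ :=
  -- The shift keeps clear of the control letters `0` to `4`. Tile codes and letter codes may
  -- coincide, since the separator `2` keeps the two kinds apart.
  Encodable.encode b + 5

/-- The tile with a given code. -/
def tileOfCode (i : ℕ) : List (Option α) × List (Option α) :=
  (Encodable.decode (i - 5)).getD ([], [])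

theorem tileOfCode_letterCode (p : List (Option α) × List (Option α)) :
    tileOfCode (letterCode p) = p := by
  simp [tileOfCode, letterCode]

theorem letterCode_injective {β : Type*} [Encodable β] :
    Function.Injective (letterCode : β → ℕ) := fun _ _ h =>
  Encodable.encode_injective (Nat.add_right_cancel h)

/-- The branches of the tiling problem with target word `f`; `pre` codes the initial word followed
by the separator. -/
def tilingBranches (f : List α) (pre : List ℕ) (b : Bool) : Branch :=
  bif b then ⟨fun i => (tileOfCode (α := α) i).2.map letterCode, pre, []⟩
  else ⟨fun i => (tileOfCode (α := α) i).1.map letterCode, [],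
    (none :: f.map some).map letterCode⟩

/-- The code of an initial word followed by the separator. -/
def initialCode (w : List α) : List ℕ :=
  (w.map some ++ [none]).map letterCode

/-- The codes of the tiles. -/
def tileCodes (A : List α) (R : List (List α × List α)) : List ℕ :=
  (tiles A R).map letterCode

/-- A bound for the codes of all letters and tiles. -/
def codeBound (A : List α) (R : List (List α × List α)) : ℕ :=
  (tileCodes A R ++ (none :: A.map some).map letterCode).sum + 1

theorem bounded_tilingBranches {A : List α} (hA : ∀ a, a ∈ A) (R : List (List α × List α))
    (f w : List α) :
    Bounded (codeBound A R) (tileCodes A R) (tilingBranches f (initialCode w)) := by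
  have hle : ∀ x ∈ tileCodes A R ++ (none :: A.map some).map letterCode, x < codeBound A R :=
    fun x hx => Nat.lt_succ_of_le (List.le_sum_of_mem hx)
  have hltr : ∀ v : List (Option α), ∀ x ∈ v.map letterCode, 5 ≤ x ∧ x < codeBound A R := by
    intro v x hx
    obtain ⟨o, -, rfl⟩ := List.mem_map.1 hx
    refine ⟨Nat.le_add_left _ _, hle _ (List.mem_append_right _ (List.mem_map_of_mem ?_))⟩
    cases o <;> simp [hA]
  constructor
  · have := hltr [none] (letterCode (none : Option α)) (by simp)
    omega
  · intro i hi
    refine ⟨?_, hle _ (List.mem_append_left _ hi)⟩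
    obtain ⟨o, -, rfl⟩ := List.mem_map.1 hi
    exact Nat.le_add_left _ _
  · rintro (_ | _)
    · simp [tilingBranches]
    · exact hltr _
  · rintro (_ | _)
    · exact hltr _
    · simp [tilingBranches]
  · rintro (_ | _) i -
    · exact hltr _
    · exact hltr _

/-- The index word is the reversed list of tile codes, because `out` undoes the reversal. -/
theorem exists_branch_eq_iff {A : List α} (hA : ∀ a, a ∈ A) (R : List (List α × List α))
    (f w : List α) : (∃ I, I ⊆ tileCodes A R ∧
      (tilingBranches f (initialCode w) false).out I ++
        (tilingBranches f (initialCode w) false).post =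
      (tilingBranches f (initialCode w) true).out I ++
        (tilingBranches f (initialCode w) true).post) ↔
      Relation.ReflTransGen (Rewrite {p | p ∈ R}) w f := by
  have key : ∀ J : List (List (Option α) × List (Option α)),
      ((tilingBranches f (initialCode w) false).out (J.map letterCode).reverse ++
        (tilingBranches f (initialCode w) false).post =
      (tilingBranches f (initialCode w) true).out (J.map letterCode).reverse ++
        (tilingBranches f (initialCode w) true).post) ↔
      J.flatMap Prod.fst ++ none :: f.map some = w.map some ++ none :: J.flatMap Prod.snd := by
    intro J
    rw [← (List.map_injective_iff.2 (letterCode_injective (β := Option α))).eq_iff]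
    simp [tilingBranches, Branch.out, initialCode, List.flatMap_map, tileOfCode_letterCode,
      List.map_flatMap]
  rw [← exists_tiling_iff hA]
  constructor
  · rintro ⟨I, hI, h⟩
    have hIJ : (I.reverse.map (tileOfCode (α := α))).map letterCode = I.reverse := by
      rw [List.map_map]
      refine (List.map_congr_left fun i hi => ?_).trans (List.map_id _)
      obtain ⟨p, -, rfl⟩ := List.mem_map.1 (hI (List.mem_reverse.1 hi))
      simp [tileOfCode_letterCode]
    refine ⟨I.reverse.map tileOfCode, ?_, (key _).1 (by rw [hIJ, List.reverse_reverse]; exact h)⟩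
    intro p hp
    obtain ⟨i, hi, rfl⟩ := List.mem_map.1 hp
    obtain ⟨p, hp, rfl⟩ := List.mem_map.1 (hI (List.mem_reverse.1 hi))
    rwa [tileOfCode_letterCode]
  · rintro ⟨J, hJ, h⟩
    refine ⟨(J.map letterCode).reverse, ?_, (key J).2 h⟩
    intro i hi
    obtain ⟨p, hp, rfl⟩ := List.mem_map.1 (List.mem_reverse.1 hi)
    exact List.mem_map_of_mem (hJ hp)

end

/-! ### Computability of the instance -/

theorem primrec_inits {α : Type*} [Primcodable α] :
    Primrec (List.inits : List α → List (List α)) := by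
  have : Primrec fun l : List α =>
      l.foldr (fun a acc => [] :: acc.map (fun x => a :: x)) [([] : List α)] := by
    refine Primrec.list_foldr (h := fun _ p => [] :: p.2.map fun x => p.1 :: x)
      Primrec.id (Primrec.const _) ?_
    refine Primrec.list_cons.comp (Primrec.const []) ?_
    exact Primrec.list_map (Primrec.snd.comp Primrec.snd)
      (Primrec.list_cons.comp (Primrec.fst.comp (Primrec.snd.comp Primrec.fst)) Primrec.snd)
  refine this.of_eq fun l => ?_
  induction l with
  | nil => rfl
  | cons a l ih => simp [ih]

theorem primrec_linearRule_mk : Primrec fun p : ℕ × List ℕ × Option (ℕ × List ℕ) =>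
    (⟨p.1, p.2.1, p.2.2⟩ : LinearRule) :=
  Primrec.of_equiv_symm (e := LinearRule.equivProd)

theorem primrec_move_mk : Primrec fun p : ℕ × Option ℕ × ℕ × ℕ × List ℕ =>
    (⟨p.1, p.2.1, p.2.2.1, p.2.2.2.1, p.2.2.2.2⟩ : Move) :=
  Primrec.of_equiv_symm (e := Move.equivProd)

theorem primrec_preRules (b : Bool) : Primrec fun pre : List ℕ => preRules pre b := by
  refine Primrec.list_cons.comp ?_ (Primrec.list_map primrec_inits ?_)
  · exact primrec_linearRule_mk.comp (Primrec.pair (Primrec.const _) (Primrec.pair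
      (Primrec.list_cons.comp (Primrec.const 2) Primrec.id) (Primrec.const none)))
  · exact primrec_linearRule_mk.comp (Primrec.pair (Primrec.const _) (Primrec.pair
      (Primrec.list_cons.comp (Primrec.const 2) Primrec.snd) (Primrec.const none)))

theorem primrec_preMove (b : Bool) : Primrec fun pre : List ℕ => preMove pre b :=
  primrec_move_mk.comp (Primrec.pair (Primrec.const _) (Primrec.pair (Primrec.const _)
    (Primrec.pair (Primrec.const _) (Primrec.pair (Primrec.const _) Primrec.id))))

theorem primrec_branchInstance {α : Type*} [Encodable α] (N : ℕ) (idx : List ℕ) (f : List α) :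
    Primrec fun pre : List ℕ => branchInstance N idx (tilingBranches f pre) := by
  have hG : Primrec fun pre : List ℕ => branchGrammar idx (tilingBranches f pre) := by
    have : Primrec fun p : ℕ × List LinearRule => (⟨p.1, p.2⟩ : LinearGrammar) :=
      Primrec.of_equiv_symm (e := LinearGrammar.equivProd)
    exact this.comp (Primrec.pair (Primrec.const 0)
      -- The branches enter here with `[]` for `pre`: the fixed productions do not see it, and the
      -- `false` branch has an empty `pre` anyway. All but the last block is therefore constant.
      (Primrec.list_append.comp (Primrec.const (⟨0, [], none⟩ ::
        (tilingBranches f [] false).fixedRules idx false ++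
        (tilingBranches f [] true).fixedRules idx true ++ preRules [] false))
        (primrec_preRules true)))
  have hM : Primrec fun pre : List ℕ => branchPDA N idx (tilingBranches f pre) := by
    have : Primrec fun p : ℕ × ℕ × List ℕ × List Move => (⟨p.1, p.2.1, p.2.2.1, p.2.2.2⟩ : PDA) :=
      Primrec.of_equiv_symm (e := PDA.equivProd)
    exact this.comp (Primrec.pair (Primrec.const 0) (Primrec.pair (Primrec.const 0)
      (Primrec.pair (Primrec.const [0, 1, 2, 5]) (Primrec.list_append.comp (Primrec.const
        (((tilingBranches f [] false).fixedMoves idx false ++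
        (tilingBranches f [] true).fixedMoves idx true ++
        (List.range N).map (fun x => ⟨5, some x, x, 5, []⟩)) ++ [preMove [] false]))
        (Primrec.list_cons.comp (primrec_preMove true) (Primrec.const []))))))
  have : Primrec fun p : List ℕ × List ℕ × List ℕ × LinearGrammar × PDA =>
      (⟨p.1, p.2.1, p.2.2.1, p.2.2.2.1, p.2.2.2.2⟩ : Instance) :=
    Primrec.of_equiv_symm (e := Instance.equivProd)
  exact this.comp (Primrec.pair (Primrec.const _) (Primrec.pair (Primrec.const _)
    (Primrec.pair (Primrec.const _) (Primrec.pair hG hM))))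

/-- If the initial words of a rewriting system are computable and observation consistency is
decided on admissible inputs, then it is decidable whether an initial word can be rewritten to
a given word. -/
theorem computablePred_rewrites {α : Type*} [Encodable α] {A : List α} (hA : ∀ a, a ∈ A)
    (R : List (List α × List α)) (f : List α) {w : ℕ → List α}
    (hw : Computable fun n => initialCode (w n)) {d : Instance →. Bool} (hd : Partrec d)
    (hdec : ∀ I : Instance, I.Admissible → ∃ b ∈ d I, (b = true ↔ I.IsObservationConsistent)) :
    ComputablePred fun n => Relation.ReflTransGen (Rewrite {p | p ∈ R}) (w n) f := by
  classical
  have hI : Computable fun n =>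
      branchInstance (codeBound A R) (tileCodes A R) (tilingBranches f (initialCode (w n))) :=
    (primrec_branchInstance _ _ f).to_comp.comp hw
  refine ⟨fun n => Classical.dec _, ?_⟩
  -- The composite is total, although `d` need not be, because every instance it meets is
  -- admissible.
  refine Partrec.of_eq (hd.comp hI) fun n => ?_
  have hB := bounded_tilingBranches hA R f (w n)
  obtain ⟨b, hb, hiff⟩ := hdec _ (branchInstance_admissible hB)
  rw [branchInstance_isObservationConsistent_iff hB, exists_branch_eq_iff hA] at hiff
  rw [Part.eq_some_iff.2 hb]
  change Part.some b = Part.some _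
  congr 1
  rw [Bool.eq_iff_iff, hiff]
  simp

/-! ### Turing machines as string rewriting systems -/

open Turing

section

variable {Γ Q : Type}

/-- The letters of configurations: tape symbols, states (`none` for the halted machine), and the
two end markers. -/
abbrev ConfigLetter (Γ Q : Type) : Type := Γ ⊕ Option Q ⊕ Bool

/-- The word `⊢ l.reverse q r ⊣` that codes a configuration. -/
def configWord (l : List Γ) (q : Option Q) (r : List Γ) : List (ConfigLetter Γ Q) :=
  Sum.inr (Sum.inr false) :: l.reverse.map Sum.inl ++
    Sum.inr (Sum.inl q) :: (r.map Sum.inl ++ [Sum.inr (Sum.inr true)])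

/-- The rewriting rules that simulate a move of the machine in state `q` reading `a`. -/
noncomputable def stepRules [Inhabited Q] [Fintype Γ] (M : TM0.Machine Γ Q) (q : Q) (a : Γ) :
    List (List (ConfigLetter Γ Q) × List (ConfigLetter Γ Q)) :=
  match M q a with
  | none => [([Sum.inr (Sum.inl (some q)), Sum.inl a], [Sum.inr (Sum.inl none)])]
  | some (q', .move .right) =>
      [([Sum.inr (Sum.inl (some q)), Sum.inl a], [Sum.inl a, Sum.inr (Sum.inl (some q'))])]
  | some (q', .move .left) => Finset.univ.toList.map fun b =>
      ([Sum.inl b, Sum.inr (Sum.inl (some q)), Sum.inl a],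
        [Sum.inr (Sum.inl (some q')), Sum.inl b, Sum.inl a])
  | some (q', .write c) =>
      [([Sum.inr (Sum.inl (some q)), Sum.inl a], [Sum.inr (Sum.inl (some q')), Sum.inl c])]

/-- The rewriting rules that add a blank at an end of the tape. -/
def blankRules [Inhabited Γ] (q : Q) :
    List (List (ConfigLetter Γ Q) × List (ConfigLetter Γ Q)) :=
  [([Sum.inr (Sum.inl (some q)), Sum.inr (Sum.inr true)],
    [Sum.inr (Sum.inl (some q)), Sum.inl default, Sum.inr (Sum.inr true)]),
   ([Sum.inr (Sum.inr false), Sum.inr (Sum.inl (some q))],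
    [Sum.inr (Sum.inr false), Sum.inl default, Sum.inr (Sum.inl (some q))])]

/-- The rewriting rules that erase the tape of the halted machine. -/
def eraseRules (a : Γ) : List (List (ConfigLetter Γ Q) × List (ConfigLetter Γ Q)) :=
  [([Sum.inr (Sum.inl none), Sum.inl a], [Sum.inr (Sum.inl none)]),
   ([Sum.inl a, Sum.inr (Sum.inl none)], [Sum.inr (Sum.inl none)])]

/-- The rewriting system that simulates a Turing machine. -/
noncomputable def machineRules [Inhabited Γ] [Inhabited Q] [Fintype Γ] [Fintype Q]
    (M : TM0.Machine Γ Q) : List (List (ConfigLetter Γ Q) × List (ConfigLetter Γ Q)) :=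
  (Finset.univ : Finset (Q × Γ)).toList.flatMap (fun p => stepRules M p.1 p.2) ++
    Finset.univ.toList.flatMap blankRules ++ Finset.univ.toList.flatMap eraseRules

theorem listBlank_mk_default [Inhabited Γ] : ListBlank.mk [(default : Γ)] = ListBlank.mk [] :=
  Quotient.sound' (Or.inr ⟨1, rfl⟩)

/-- A factorization of a configuration word around a state letter. -/
theorem configWord_eq {l : List Γ} {q o : Option Q} {r : List Γ}
    {x y : List (ConfigLetter Γ Q)}
    (h : x ++ Sum.inr (Sum.inl o) :: y = configWord l q r) :
    x = Sum.inr (Sum.inr false) :: l.reverse.map Sum.inl ∧ o = q ∧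
      y = r.map Sum.inl ++ [Sum.inr (Sum.inr true)] := by
  obtain ⟨h1, h2, h3⟩ := append_cons_inj_of_pred
    (fun s : ConfigLetter Γ Q => ∃ o, s = Sum.inr (Sum.inl o)) ⟨o, rfl⟩
    (by simp) (by simp) h.symm
  exact ⟨h1.symm, by simpa using h2.symm, h3.symm⟩

theorem eq_cons_of_map_append {r : List Γ} {a : Γ} {y : List (ConfigLetter Γ Q)}
    (h : Sum.inl a :: y = r.map Sum.inl ++ [Sum.inr (Sum.inr true)]) :
    ∃ r', r = a :: r' ∧ y = r'.map Sum.inl ++ [Sum.inr (Sum.inr true)] := by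
  rcases r with _ | ⟨b, r⟩
  · simp at h
  · simp only [List.map_cons, List.cons_append, List.cons.injEq, Sum.inl.injEq] at h
    exact ⟨r, by rw [h.1], h.2⟩

theorem eq_cons_of_append_singleton {l : List Γ} {b : Γ} {x : List (ConfigLetter Γ Q)}
    (h : x ++ [Sum.inl b] = Sum.inr (Sum.inr false) :: l.reverse.map Sum.inl) :
    ∃ l', l = b :: l' ∧ x = Sum.inr (Sum.inr false) :: l'.reverse.map Sum.inl := by
  rcases l with _ | ⟨c, l⟩
  · rcases x with _ | ⟨_, x⟩ <;> simp at h
  · simp only [List.reverse_cons, List.map_append, List.map_cons, List.map_nil,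
      ← List.cons_append] at h
    obtain ⟨rfl, hb⟩ := List.append_inj' h rfl
    simp only [List.cons.injEq, Sum.inl.injEq, and_true] at hb
    exact ⟨l, by rw [hb], rfl⟩

theorem rewrite_of_eq {α : Type*} {R : Set (List α × List α)} (x y : List α) {l r w w' : List α}
    (h : (l, r) ∈ R) (hw : w = x ++ l ++ y) (hw' : w' = x ++ r ++ y) : Rewrite R w w' := by
  subst hw hw'
  exact .mk x y l r h

variable [Inhabited Γ] [Inhabited Q] [Fintype Γ] [Fintype Q] {M : TM0.Machine Γ Q}

theorem mem_machineRules {p : List (ConfigLetter Γ Q) × List (ConfigLetter Γ Q)} :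
    p ∈ machineRules M ↔ (∃ q a, p ∈ stepRules M q a) ∨ (∃ q, p ∈ blankRules q) ∨
      ∃ a, p ∈ eraseRules a := by
  simp [machineRules]

/-- The word has a single state letter, so a rule can match only around it. Step rules follow the
machine, blank rules leave the tape unchanged up to trailing blanks, and erasing rules need the
halted letter, which appears only when the machine has no move. -/
theorem halts_or_reaches_of_rewrite {c : TM0.Cfg Γ Q} {l r : List Γ} {q : Q}
    {w : List (ConfigLetter Γ Q)}
    (hc : StateTransition.Reaches (TM0.step M) c ⟨q, Tape.mk' (ListBlank.mk l) (ListBlank.mk r)⟩)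
    (h : Rewrite {p | p ∈ machineRules M} (configWord l (some q) r) w) :
    (StateTransition.eval (TM0.step M) c).Dom ∨ ∃ l' q' r', w = configWord l' (some q') r' ∧
      StateTransition.Reaches (TM0.step M) c
        ⟨q', Tape.mk' (ListBlank.mk l') (ListBlank.mk r')⟩ := by
  generalize hw : configWord l (some q) r = w₀ at h
  obtain ⟨x, y, u, v, huv⟩ := h
  rcases mem_machineRules.1 huv with ⟨q₁, a, huv⟩ | ⟨q₁, huv⟩ | ⟨a, huv⟩
  · unfold stepRules at huv
    split at huv
    · rename_i hM
      simp only [List.mem_singleton, Prod.mk.injEq] at huv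
      obtain ⟨rfl, rfl⟩ := huv
      obtain ⟨rfl, h2, h3⟩ := configWord_eq (x := x) (by simpa using hw.symm)
      obtain rfl : q₁ = q := by simpa using h2
      obtain ⟨r', rfl, rfl⟩ := eq_cons_of_map_append h3
      refine Or.inl (Part.dom_iff_mem.2 ⟨_, StateTransition.mem_eval.2 ⟨hc, ?_⟩⟩)
      simp [TM0.step, hM]
    · rename_i q' hM
      simp only [List.mem_singleton, Prod.mk.injEq] at huv
      obtain ⟨rfl, rfl⟩ := huv
      obtain ⟨rfl, h2, h3⟩ := configWord_eq (x := x) (by simpa using hw.symm)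
      obtain rfl : q₁ = q := by simpa using h2
      obtain ⟨r', rfl, rfl⟩ := eq_cons_of_map_append h3
      refine Or.inr ⟨a :: l, q', r', by simp [configWord], hc.tail ?_⟩
      simp [TM0.step, hM]
    · rename_i q' hM
      simp only [List.mem_map, Prod.mk.injEq] at huv
      obtain ⟨b, -, rfl, rfl⟩ := huv
      obtain ⟨h1, h2, h3⟩ := configWord_eq (x := x ++ [Sum.inl b]) (by simpa using hw.symm)
      obtain rfl : q₁ = q := by simpa using h2
      obtain ⟨r', rfl, rfl⟩ := eq_cons_of_map_append h3
      obtain ⟨l', rfl, rfl⟩ := eq_cons_of_append_singleton h1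
      refine Or.inr ⟨l', q', b :: a :: r', by simp [configWord], hc.tail ?_⟩
      simp [TM0.step, hM]
    · rename_i q' c' hM
      simp only [List.mem_singleton, Prod.mk.injEq] at huv
      obtain ⟨rfl, rfl⟩ := huv
      obtain ⟨rfl, h2, h3⟩ := configWord_eq (x := x) (by simpa using hw.symm)
      obtain rfl : q₁ = q := by simpa using h2
      obtain ⟨r', rfl, rfl⟩ := eq_cons_of_map_append h3
      refine Or.inr ⟨l, q', c' :: r', by simp [configWord], hc.tail ?_⟩
      simp only [TM0.step, Tape.mk'_head, ListBlank.head_mk, List.headI_cons, hM]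
      rw [← ListBlank.cons_mk, ← ListBlank.cons_mk]
      simp [Tape.write_mk']
  · simp only [blankRules, List.mem_cons, List.not_mem_nil, or_false, Prod.mk.injEq] at huv
    rcases huv with ⟨rfl, rfl⟩ | ⟨rfl, rfl⟩
    · obtain ⟨rfl, h2, h3⟩ := configWord_eq (x := x) (by simpa using hw.symm)
      obtain rfl : q₁ = q := by simpa using h2
      rcases r with _ | ⟨b, r⟩
      · obtain rfl : y = [] := by simpa using h3
        exact Or.inr ⟨l, q₁, [default], by simp [configWord], by rwa [listBlank_mk_default]⟩
      · simp at h3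
    · obtain ⟨h1, h2, h3⟩ := configWord_eq (x := x ++ [Sum.inr (Sum.inr false)])
        (by simpa using hw.symm)
      obtain rfl : q₁ = q := by simpa using h2
      rcases l with _ | ⟨b, l⟩
      · obtain rfl : x = [] := by simpa using h1
        exact Or.inr ⟨[default], q₁, r, by simp [configWord, h3], by rwa [listBlank_mk_default]⟩
      · simp only [List.reverse_cons, List.map_append, List.map_cons, List.map_nil,
          ← List.cons_append] at h1
        simpa using (List.append_inj' h1 rfl).2
  · simp only [eraseRules, List.mem_cons, List.not_mem_nil, or_false, Prod.mk.injEq] at huv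
    rcases huv with ⟨rfl, rfl⟩ | ⟨rfl, rfl⟩
    · obtain ⟨-, h2, -⟩ := configWord_eq (x := x) (by simpa using hw.symm)
      simp at h2
    · obtain ⟨-, h2, -⟩ := configWord_eq (x := x ++ [Sum.inl a]) (by simpa using hw.symm)
      simp at h2

theorem halts_of_rewrites {L : List Γ}
    (h : Relation.ReflTransGen (Rewrite {p | p ∈ machineRules M})
      (configWord [] (some default) L) (configWord [] none [])) : (TM0.eval M L).Dom := by
  have key : ∀ w, Relation.ReflTransGen (Rewrite {p | p ∈ machineRules M})
      (configWord [] (some default) L) w →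
      (StateTransition.eval (TM0.step M) (TM0.init L)).Dom ∨
      ∃ l' q' r', w = configWord l' (some q') r' ∧ StateTransition.Reaches (TM0.step M)
        (TM0.init L) ⟨q', Tape.mk' (ListBlank.mk l') (ListBlank.mk r')⟩ := by
    intro w h
    induction h with
    | refl => exact Or.inr ⟨[], default, L, rfl, .refl⟩
    | tail _ h ih =>
      rcases ih with ih | ⟨l, q, r, rfl, hc⟩
      · exact Or.inl ih
      · exact halts_or_reaches_of_rewrite hc h
  rcases key _ h with h | ⟨l, q, r, h, -⟩
  · exact h
  · obtain ⟨-, h, -⟩ := configWord_eq (x := [Sum.inr (Sum.inr false)])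
      (y := [Sum.inr (Sum.inr true)]) (l := l) (r := r) (q := some q) (o := none) h
    simp at h

theorem rewrites_right_ne_nil (l : List Γ) (q : Q) (r : List Γ) : ∃ a r',
    ListBlank.mk (a :: r') = ListBlank.mk r ∧
    Relation.ReflTransGen (Rewrite {p | p ∈ machineRules M}) (configWord l (some q) r)
      (configWord l (some q) (a :: r')) := by
  rcases r with _ | ⟨a, r⟩
  · refine ⟨default, [], listBlank_mk_default, .single (rewrite_of_eq
      (Sum.inr (Sum.inr false) :: l.reverse.map Sum.inl) []
      (mem_machineRules.2 (Or.inr (Or.inl ⟨q, List.mem_cons_self⟩))) ?_ ?_)⟩ <;>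
    simp [configWord]
  · exact ⟨a, r, rfl, .refl⟩

theorem rewrites_left_ne_nil (l : List Γ) (q : Q) (r : List Γ) : ∃ a l',
    ListBlank.mk (a :: l') = ListBlank.mk l ∧
    Relation.ReflTransGen (Rewrite {p | p ∈ machineRules M}) (configWord l (some q) r)
      (configWord (a :: l') (some q) r) := by
  rcases l with _ | ⟨a, l⟩
  · refine ⟨default, [], listBlank_mk_default, .single (rewrite_of_eq
      [] (r.map Sum.inl ++ [Sum.inr (Sum.inr true)])
      (mem_machineRules.2 (Or.inr (Or.inl ⟨q, List.mem_cons_of_mem _ List.mem_cons_self⟩)))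
      ?_ ?_)⟩ <;>
    simp [configWord]
  · exact ⟨a, l, rfl, .refl⟩

/-- The rule of the move may need a tape symbol where the word already ends; a blank rule supplies
it beforehand. -/
theorem rewrites_of_step {l r : List Γ} {q : Q} {c : TM0.Cfg Γ Q}
    (h : TM0.step M ⟨q, Tape.mk' (ListBlank.mk l) (ListBlank.mk r)⟩ = some c) :
    ∃ l' r', c.Tape = Tape.mk' (ListBlank.mk l') (ListBlank.mk r') ∧
      Relation.ReflTransGen (Rewrite {p | p ∈ machineRules M}) (configWord l (some q) r)
        (configWord l' (some c.q) r') := by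
  obtain ⟨a, r', hr, hrw⟩ := rewrites_right_ne_nil (M := M) l q r
  rw [← hr] at h
  simp only [TM0.step, Tape.mk'_head, ListBlank.head_mk, List.headI_cons, Option.map_eq_some_iff]
    at h
  obtain ⟨⟨q', s⟩, hM, rfl⟩ := h
  rcases s with (_ | _) | b
  · obtain ⟨b, l', hl, hlw⟩ := rewrites_left_ne_nil (M := M) l q (a :: r')
    refine ⟨l', b :: a :: r', ?_, hrw.trans (hlw.tail (rewrite_of_eq
      (Sum.inr (Sum.inr false) :: l'.reverse.map Sum.inl)
      (r'.map Sum.inl ++ [Sum.inr (Sum.inr true)])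
      (l := [Sum.inl b, Sum.inr (Sum.inl (some q)), Sum.inl a])
      (r := [Sum.inr (Sum.inl (some q')), Sum.inl b, Sum.inl a])
      (mem_machineRules.2 (Or.inl ⟨q, a, by simp [stepRules, hM]⟩)) ?_ ?_))⟩
    · rw [← hl]; simp
    · simp [configWord]
    · simp [configWord]
  · refine ⟨a :: l, r', by simp, hrw.tail (rewrite_of_eq
      (Sum.inr (Sum.inr false) :: l.reverse.map Sum.inl)
      (r'.map Sum.inl ++ [Sum.inr (Sum.inr true)])
      (l := [Sum.inr (Sum.inl (some q)), Sum.inl a])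
      (r := [Sum.inl a, Sum.inr (Sum.inl (some q'))])
      (mem_machineRules.2 (Or.inl ⟨q, a, by simp [stepRules, hM]⟩)) ?_ ?_)⟩ <;>
    simp [configWord]
  · refine ⟨l, b :: r', ?_, hrw.tail (rewrite_of_eq
      (Sum.inr (Sum.inr false) :: l.reverse.map Sum.inl)
      (r'.map Sum.inl ++ [Sum.inr (Sum.inr true)])
      (l := [Sum.inr (Sum.inl (some q)), Sum.inl a])
      (r := [Sum.inr (Sum.inl (some q')), Sum.inl b])
      (mem_machineRules.2 (Or.inl ⟨q, a, by simp [stepRules, hM]⟩)) ?_ ?_)⟩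
    · rw [← ListBlank.cons_mk, ← ListBlank.cons_mk]
      simp [Tape.write_mk']
    · simp [configWord]
    · simp [configWord]

theorem rewrites_erase (l r : List Γ) :
    Relation.ReflTransGen (Rewrite {p | p ∈ machineRules M}) (configWord l none r)
      (configWord [] none []) := by
  induction r with
  | nil =>
    induction l with
    | nil => exact .refl
    | cons a l ih =>
      refine .head (rewrite_of_eq (Sum.inr (Sum.inr false) :: l.reverse.map Sum.inl)
        [Sum.inr (Sum.inr true)] (mem_machineRules.2 (Or.inr (Or.inr
          ⟨a, List.mem_cons_of_mem _ List.mem_cons_self⟩))) ?_ ?_) ih <;>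
      simp [configWord]
  | cons a r ih =>
    refine .head (rewrite_of_eq (Sum.inr (Sum.inr false) :: l.reverse.map Sum.inl)
      (r.map Sum.inl ++ [Sum.inr (Sum.inr true)]) (mem_machineRules.2 (Or.inr (Or.inr
        ⟨a, List.mem_cons_self⟩))) ?_ ?_) ih <;>
    simp [configWord]

theorem rewrites_of_halts {L : List Γ} (h : (TM0.eval M L).Dom) :
    Relation.ReflTransGen (Rewrite {p | p ∈ machineRules M})
      (configWord [] (some default) L) (configWord [] none []) := by
  have h' : (StateTransition.eval (TM0.step M) (TM0.init L)).Dom := h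
  obtain ⟨c, hc⟩ := Part.dom_iff_mem.1 h'
  obtain ⟨hc, hs⟩ := StateTransition.mem_eval.1 hc
  have key : ∀ c, StateTransition.Reaches (TM0.step M) (TM0.init L) c →
      ∃ l r, c.Tape = Tape.mk' (ListBlank.mk l) (ListBlank.mk r) ∧
        Relation.ReflTransGen (Rewrite {p | p ∈ machineRules M})
          (configWord [] (some default) L) (configWord l (some c.q) r) := by
    intro c hc
    induction hc with
    | refl => exact ⟨[], L, rfl, .refl⟩
    | @tail c c' _ h ih =>
      obtain ⟨l, r, hT, hrw⟩ := ih
      obtain ⟨q, T⟩ := c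
      obtain rfl : T = _ := hT
      obtain ⟨l', r', hT', hrw'⟩ := rewrites_of_step h
      exact ⟨l', r', hT', hrw.trans hrw'⟩
  obtain ⟨l, r, hT, hrw⟩ := key c hc
  obtain ⟨q, T⟩ := c
  obtain rfl : T = _ := hT
  obtain ⟨a, r', hr, hrw'⟩ := rewrites_right_ne_nil (M := M) l q r
  rw [← hr] at hs
  have hM : M q a = none := by simpa [TM0.step] using hs
  refine (hrw.trans (hrw'.tail ?_)).trans (rewrites_erase l r')
  refine rewrite_of_eq (Sum.inr (Sum.inr false) :: l.reverse.map Sum.inl)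
    (r'.map Sum.inl ++ [Sum.inr (Sum.inr true)])
    (l := [Sum.inr (Sum.inl (some q)), Sum.inl a]) (r := [Sum.inr (Sum.inl none)])
    (mem_machineRules.2 (Or.inl ⟨q, a, by simp [stepRules, hM]⟩)) ?_ ?_ <;>
  simp [configWord]

theorem rewrites_iff_halts {L : List Γ} :
    Relation.ReflTransGen (Rewrite {p | p ∈ machineRules M})
      (configWord [] (some default) L) (configWord [] none []) ↔ (TM0.eval M L).Dom :=
  ⟨halts_of_rewrites, rewrites_of_halts⟩

end

/-! ### A Turing machine with an undecidable halting problem -/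

/-- A stack machine with finitely many labels is simulated by a Turing machine with finitely many
states. -/
theorem exists_tm0_of_tm2 {K : Type} [DecidableEq K] {Γ : K → Type} {Λ σ : Type} [Inhabited Λ]
    [Inhabited σ] [Fintype σ] (M : Λ → TM2.Stmt Γ Λ σ) {S : Finset Λ} (hS : TM2.Supports M S)
    (k : K) : ∃ (Q : Type) (_ : Fintype Q) (_ : Inhabited Q)
      (M' : TM0.Machine (TM2to1.Γ' K Γ) Q), ∀ L : List (Γ k),
        (TM0.eval M' (TM2to1.trInit k L)).Dom ↔ (TM2.eval M k L).Dom := by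
  classical
  have hS0 := TM1to0.tr_supports _ (TM2to1.tr_supports M hS)
  set S0 := TM1to0.trStmts (TM2to1.tr M) (TM2to1.trSupp M S)
  set M0 := TM1to0.tr (TM2to1.tr M)
  have hd : default ∈ S0 := hS0.1
  let : Inhabited {q // q ∈ S0} := ⟨⟨default, hd⟩⟩
  let f : PointedMap (TM2to1.Γ' K Γ) (TM2to1.Γ' K Γ) := ⟨id, rfl⟩
  -- The full state type need not be finite. This retraction onto the finite supporting set serves
  -- to restrict the machine; its value off the set is immaterial because the set is closed under
  -- moves.
  let g : PointedMap (TM1to0.Λ' (TM2to1.tr M)) {q // q ∈ S0} :=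
    ⟨fun q => if h : q ∈ S0 then ⟨q, h⟩ else default, dif_pos hd⟩
  refine ⟨{q // q ∈ S0}, inferInstance, inferInstance, M0.map f f g Subtype.val, fun L => ?_⟩
  have hg : ∀ q ∈ (S0 : Set (TM1to0.Λ' (TM2to1.tr M))), (g q).val = q := fun q hq => by
    change (dite _ _ _ : {q // q ∈ S0}).val = q
    rw [dif_pos (Finset.mem_coe.1 hq)]
  rw [← TM2to1.tr_eval_dom, ← TM1to0.tr_eval]
  refine StateTransition.tr_eval_dom
    (TM0.Machine.map_respects M0 f f g Subtype.val hS0 (fun _ => rfl) hg) ⟨hd, ?_⟩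
  rw [TM0.map_init]
  exact congrArg TM0.init (List.map_id _)

theorem trNat_two_pow (m : ℕ) : PartrecToTM2.trNat (2 ^ m) =
    List.replicate m PartrecToTM2.Γ'.bit0 ++ [PartrecToTM2.Γ'.bit1] := by
  have h : ∀ m, ∃ p : PosNum, ((2 ^ m : ℕ) : Num) = Num.pos p ∧ PartrecToTM2.trPosNum p =
      List.replicate m PartrecToTM2.Γ'.bit0 ++ [PartrecToTM2.Γ'.bit1] := by
    intro m
    induction m with
    | zero => exact ⟨1, rfl, rfl⟩
    | succ m ih =>
      obtain ⟨p, hp, ht⟩ := ih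
      refine ⟨p.bit0, ?_, ?_⟩
      · rw [pow_succ, Nat.cast_mul, hp]
        have : ((2 : ℕ) : Num) = 2 := rfl
        rw [this, mul_two]
        exact congrArg Num.pos (PosNum.bit0_of_bit0 p)
      · simp [PartrecToTM2.trPosNum, ht, List.replicate_succ]
  obtain ⟨p, hp, ht⟩ := h m
  rw [PartrecToTM2.trNat, hp]
  exact ht

/-- Numerals are binary with the least significant bit first, so `2 ^ m` is a block of `m` zeros and
a one. The tape lists the stack from its bottom, which turns this into a fixed beginning followed by
`m` copies of one symbol. -/
theorem exists_tm0_of_partrec {f : ℕ →. ℕ} (hf : Partrec f) :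
    ∃ (Γ Q : Type) (_ : Fintype Γ) (_ : Fintype Q) (_ : Inhabited Γ) (_ : Inhabited Q)
      (M : TM0.Machine Γ Q) (L : List Γ) (z : Γ), ∀ m,
        (TM0.eval M (L ++ List.replicate m z)).Dom ↔ (f (2 ^ m)).Dom := by
  obtain ⟨c, hc⟩ := ToPartrec.Code.exists_code (Nat.Partrec'.part_iff₁.2 hf)
  let : Fintype PartrecToTM2.K' := ⟨{.main, .rev, .aux, .stack}, by rintro (_ | _ | _ | _) <;> simp⟩
  obtain ⟨Q, hQ, hQ', M, hM⟩ := @exists_tm0_of_tm2 _ _ _ _ _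
    ⟨PartrecToTM2.trNormal c .halt⟩ _ _ PartrecToTM2.tr _
    (PartrecToTM2.tr_supports c .halt) PartrecToTM2.K'.main
  -- A tape symbol with `a` on the main stack and nothing on the others; `b` flags the bottom cell.
  let s : Bool → PartrecToTM2.Γ' → TM2to1.Γ' PartrecToTM2.K' fun _ => PartrecToTM2.Γ' := fun b a =>
    (b, Function.update (fun _ => none) PartrecToTM2.K'.main (some a))
  refine ⟨TM2to1.Γ' PartrecToTM2.K' fun _ => PartrecToTM2.Γ', Q, inferInstance, hQ,
    inferInstance, hQ', M, [s true .cons, s false .bit1], s false .bit0, fun m => ?_⟩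
  have h := hM (PartrecToTM2.trList [2 ^ m])
  have hL : TM2to1.trInit (Γ := fun _ => PartrecToTM2.Γ') PartrecToTM2.K'.main
      (PartrecToTM2.trList [2 ^ m]) =
      [s true .cons, s false .bit1] ++ List.replicate m (s false .bit0) := by
    have hr : (PartrecToTM2.trList [2 ^ m]).reverse =
        .cons :: .bit1 :: List.replicate m .bit0 := by
      simp [PartrecToTM2.trList, trNat_two_pow]
    unfold TM2to1.trInit
    rw [hr]
    exact congrArg (fun t => s true .cons :: s false .bit1 :: t) List.map_replicate
  rw [hL] at h
  have hinit : @TM2.init _ _ _ _ ⟨PartrecToTM2.trNormal c .halt⟩ _ _ PartrecToTM2.K'.main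
      (PartrecToTM2.trList [2 ^ m]) = PartrecToTM2.init c [2 ^ m] := by
    unfold TM2.init PartrecToTM2.init
    congr 1
    funext k
    cases k <;> rfl
  refine h.trans ((iff_of_eq (congrArg
    (fun c => (StateTransition.eval (TM2.step PartrecToTM2.tr) c).Dom) hinit)).trans ?_)
  have h1 := congrArg Part.Dom (PartrecToTM2.tr_eval c [2 ^ m])
  have h2 := congrArg Part.Dom (hc ⟨[2 ^ m], rfl⟩)
  exact (iff_of_eq h1).trans (iff_of_eq h2)

/-- A partial recursive function whose domain, restricted to the powers of two, is undecidable. -/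
theorem exists_partrec_not_computablePred :
    ∃ f : ℕ →. ℕ, Partrec f ∧ ¬ ComputablePred fun m => (f (2 ^ m)).Dom := by
  let g : ℕ →. ℕ := fun m => Nat.Partrec.Code.eval (Denumerable.ofNat Nat.Partrec.Code m) 0
  have hg : Partrec g := Nat.Partrec.Code.eval_part.comp (Computable.ofNat _) (Computable.const 0)
  have hpow : Primrec fun m : ℕ => 2 ^ m := by
    refine (Primrec.nat_rec₁ 1 (f := fun _ k => 2 * k)
      (Primrec.nat_mul.comp (Primrec.const 2) Primrec.snd)).of_eq fun m => ?_
    induction m with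
    | zero => rfl
    | succ m ih => rw [pow_succ, mul_comm, ← ih]
  -- The search diverges off the powers of two, which is harmless, since only the values at `2 ^ m`
  -- are used.
  let log : ℕ →. ℕ := fun x => Nat.rfind fun m => Part.some (decide (2 ^ m = x))
  have hlog : Partrec log := by
    refine Partrec.rfind ?_
    have : Computable₂ fun x m : ℕ => decide (2 ^ m = x) :=
      (PrimrecPred.decide
        (Primrec.eq.comp (hpow.comp Primrec.snd) Primrec.fst)).to_comp
    exact this.partrec₂
  have hlog' : ∀ m, log (2 ^ m) = Part.some m := by
    intro m
    refine Part.eq_some_iff.2 (Nat.mem_rfind.2 ⟨by simp, fun {k} hk => ?_⟩)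
    simpa using (Nat.pow_lt_pow_right (a := 2) (by norm_num) hk).ne
  refine ⟨fun x => (log x).bind g, hlog.bind (hg.comp Computable.snd).to₂, fun h => ?_⟩
  simp only [hlog'] at h
  refine ComputablePred.halting_problem 0 ?_
  exact ComputablePred.computable_of_manyOneReducible
    ⟨_, Computable.encode, fun c => by simp [g]⟩ h

theorem computable_initialCode {Γ Q : Type} [Encodable (ConfigLetter Γ Q)] (L : List Γ) (z : Γ)
    (q : Option Q) : Computable fun m : ℕ =>
      initialCode (configWord [] q (L ++ List.replicate m z)) := by
  have : Primrec fun m : ℕ =>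
      ((configWord [] q L).dropLast.map some).map letterCode ++
        ((List.range m).map fun _ => letterCode (some (Sum.inl z : ConfigLetter Γ Q))) ++
        [letterCode (some (Sum.inr (Sum.inr true) : ConfigLetter Γ Q)),
          letterCode (none : Option (ConfigLetter Γ Q))] :=
    Primrec.list_append.comp (Primrec.list_append.comp (Primrec.const _)
      (Primrec.list_map Primrec.list_range (Primrec.const _))) (Primrec.const _)
  refine this.to_comp.of_eq fun m => ?_
  have hdrop : (configWord [] q L).dropLast =
      Sum.inr (Sum.inr false) :: Sum.inr (Sum.inl q) :: L.map Sum.inl := by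
    rw [← List.dropLast_concat (l₁ := Sum.inr (Sum.inr false) :: Sum.inr (Sum.inl q) ::
      L.map Sum.inl) (b := (Sum.inr (Sum.inr true) : ConfigLetter Γ Q))]
    rfl
  rw [hdrop]
  simp [initialCode, configWord]

end ObsCons

/-- Observation consistency of prefix-closed, linear, deterministic context-free languages is
undecidable: no partial recursive function halts with the correct answer on every admissible
input, whatever it may do on the other inputs. -/
theorem mainTheorem1 :
    ¬ ∃ f : ObsCons.Instance →. Bool, Partrec f ∧
      ∀ I : ObsCons.Instance, I.Admissible →
        ∃ b ∈ f I, (b = true ↔ I.IsObservationConsistent) := by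
  rintro ⟨d, hd, hdec⟩
  obtain ⟨f, hf, hundec⟩ := ObsCons.exists_partrec_not_computablePred
  obtain ⟨Γ, Q, _, _, _, _, M, L, z, hM⟩ := ObsCons.exists_tm0_of_partrec hf
  -- Any coding of the finite set of letters will do, as it enters the reduction only through
  -- constants.
  let : Encodable (ObsCons.ConfigLetter Γ Q) := Fintype.toEncodable _
  refine hundec ((ObsCons.computablePred_rewrites (A := Finset.univ.toList) (by simp)
    (ObsCons.machineRules M) (ObsCons.configWord [] none [])
    (ObsCons.computable_initialCode L z (some default)) hd hdec).of_eq fun m => ?_)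
  rw [ObsCons.rewrites_iff_halts, hM]
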